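/- Let $n\ge 1$, $R\in(0,+\infty]$, and let $\xi\in C^\infty([0,R))$ satisfy $\xi>0$ on $(0,R)$, $\xi^{(2k)}(0)=0$ for all $k\ge 0$ and $\xi'(0)=1$. Let $P$ be the $n$-dimensional model manifold with pole $o$, i.e. the ball of radius $R$ with the metric $dr^2+\xi^2(r)\,d\theta^2$ in geodesic polar coordinates $(r,\theta)\in(0,R)\times\mathbb S^{n-1}$. Let $\psi=\psi(r)$ be a smooth radial function on $P$, and let $M=P\times_{e^{-\psi}}\mathbb R$, with the metric $dr^2+\xi^2(r)\,d\theta^2+e^{-2\psi(r)}ds^2$ and the Killing field $Y=\partial_s$, $|Y|=e^{-\psi}$. For $r\in[0,R)$ put $$A(r)=e^{-\psi(r)}\xi^{n-1}(r),\qquad V(r)=\int_0^r e^{-\psi(\tau)}\xi^{n-1}(\tau)\,d\tau .$$ Suppose that $A/V$ is non-increasing on $(0,R)$. Let $H_0$ be a non-positive constant such that $$n|H_0|=\frac{A(r_0)}{V(r_0)}$$ for some $r_0\in(0,R)$ with $(A/V)'(r_0)\neq 0$. Then the integral $$u(r)=\int_{r_0}^r e^{\psi(\tau)}\,\frac{nH_0V(\tau)}{\sqrt{A^2(\tau)-n^2H_0^2V^2(\tau)}}\,d\tau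 ,\qquad r\in[0,r_0],$$ converges, and the rotationally symmetric Killing graph $\Sigma_0=\{(x,u(r(x))) : r(x)\le r_0\}\subset M$ is a compact smooth embedded hypersurface with boundary $\partial B_{r_0}(o)\times\{0\}$. The function $x\mapsto u(r(x))$ is smooth on $B_{r_0}(o)$, and over $B_{r_0}(o)$ the graph has constant mean curvature $H=H_0$ ($\tfrac1n$ times the trace of the second fundamental form) with respect to its upward pointing unit normal $\mathcal N$, $\langle\mathcal N,Y\rangle>0$. Moreover, for all $r\in[0,r_0]$, $$e^{-\psi(r)}u(r)\le e^{\sup_{B_{r_0}(o)}\psi-\inf_{B_{r_0}(o)}\psi}\int_0^{r_0}\frac{-nH_0}{\sqrt{\frac{A^2(\tau)}{V^2(\tau)}-n^2H_0^2}}\,d\tau ,$$ where the integral on the right-hand side converges. -/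

import Mathlib

open Set MeasureTheory
open scoped ContDiff

noncomputable section

namespace KillingGraph

/-! ### Hypersurfaces in a Riemannian metric given in one global chart

A Riemannian metric on an open subset of a normed space `E` is written as `G : E → E → E → ℝ`,
where `G p v w` is the inner product of the tangent vectors `v`, `w` at the point `p`. -/

section Metric

variable {E : Type*} [NormedAddCommGroup E] [NormedSpace ℝ E]

/-- Christoffel symbols of the first kind of the Levi-Civita connection (Koszul formula for
constant fields): `G p (Γ_p (v, w)) z`. -/
def christoffelFirst (G : E → E → E → ℝ) (p v w z : E) : ℝ :=
  (1 / 2) * (fderiv ℝ (fun q => G q w z) p v + fderiv ℝ (fun q => G q v z) p w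
    - fderiv ℝ (fun q => G q v w) p z)

variable {n : ℕ}

/-- `N` is a unit normal at `X x` of the parametrized hypersurface `X`. -/
def IsUnitNormal (G : E → E → E → ℝ) (X : EuclideanSpace ℝ (Fin n) → E)
    (x : EuclideanSpace ℝ (Fin n)) (N : E) : Prop :=
  G (X x) N N = 1 ∧ ∀ v, G (X x) (fderiv ℝ X x v) N = 0

/-- First fundamental form of `X` at `x`. -/
def firstForm (G : E → E → E → ℝ) (X : EuclideanSpace ℝ (Fin n) → E)
    (x v w : EuclideanSpace ℝ (Fin n)) : ℝ :=
  G (X x) (fderiv ℝ X x v) (fderiv ℝ X x w)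

/-- Second fundamental form of `X` at `x` with respect to the normal `N`: the inner product
with `N` of the ambient covariant derivative of `dX(w)` in the direction of `v`. -/
def secondForm (G : E → E → E → ℝ) (X : EuclideanSpace ℝ (Fin n) → E) (N : E)
    (x v w : EuclideanSpace ℝ (Fin n)) : ℝ :=
  G (X x) (fderiv ℝ (fderiv ℝ X) x v w) N
    + christoffelFirst G (X x) (fderiv ℝ X x v) (fderiv ℝ X x w) N

/-- Normalized mean curvature of `X` at `x` with respect to the normal `N`: `1/n` times the trace
of the second fundamental form with respect to the first one. -/
def meanCurvature (G : E → E → E → ℝ) (X : EuclideanSpace ℝ (Fin n) → E) (N : E)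
    (x : EuclideanSpace ℝ (Fin n)) : ℝ :=
  (1 / (n : ℝ)) * Matrix.trace
    ((Matrix.of fun i j : Fin n =>
        firstForm G X x (EuclideanSpace.single i 1) (EuclideanSpace.single j 1))⁻¹ *
      Matrix.of fun i j : Fin n =>
        secondForm G X N x (EuclideanSpace.single i 1) (EuclideanSpace.single j 1))

/-- `S` is a smooth embedded hypersurface with boundary `B`: it is locally a regular level set
`f = 0` away from `B`, and locally `f = 0`, `0 ≤ g` at the points of `B`, where `f`, `g` are
smooth with independent differentials and `B` is given locally by `f = g = 0`. -/
structure IsHypersurfaceWithBoundary (S B : Set E) : Prop where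
  boundary_subset : B ⊆ S
  interior_point : ∀ p ∈ S \ B, ∃ U : Set E, IsOpen U ∧ p ∈ U ∧ ∃ f : E → ℝ,
    ContDiffOn ℝ ∞ f U ∧ fderiv ℝ f p ≠ 0 ∧ S ∩ U = {q | q ∈ U ∧ f q = 0}
  boundary_point : ∀ p ∈ B, ∃ U : Set E, IsOpen U ∧ p ∈ U ∧ ∃ f g : E → ℝ,
    ContDiffOn ℝ ∞ f U ∧ ContDiffOn ℝ ∞ g U ∧
    LinearIndependent ℝ ![fderiv ℝ f p, fderiv ℝ g p] ∧
    S ∩ U = {q | q ∈ U ∧ f q = 0 ∧ 0 ≤ g q} ∧ B ∩ U = {q | q ∈ U ∧ f q = 0 ∧ g q = 0}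

end Metric

/-! ### Model manifolds and their warped products with the line -/

/-- Conditions on the warping function of the model metric `dr² + ξ(r)² dθ²` on a ball of radius
`R ∈ (0, ∞]`. -/
structure IsModelWarping (R : EReal) (ξ : ℝ → ℝ) : Prop where
  smooth : ContDiffOn ℝ ∞ ξ {r : ℝ | 0 ≤ r ∧ (r : EReal) < R}
  pos : ∀ r : ℝ, 0 < r → (r : EReal) < R → 0 < ξ r
  even_deriv : ∀ k : ℕ,
    iteratedDerivWithin (2 * k) ξ {r : ℝ | 0 ≤ r ∧ (r : EReal) < R} 0 = 0
  deriv_zero : derivWithin ξ {r : ℝ | 0 ≤ r ∧ (r : EReal) < R} 0 = 1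

/-- The underlying set of the model manifold `P`: the ball of radius `R` in `ℝⁿ`. The pole is `0`,
the distance from the pole is `r = ‖x‖` (geodesic normal coordinates), so that the geodesic balls
about the pole are the balls `‖x‖ < r`. -/
def modelBall (n : ℕ) (R : EReal) : Set (EuclideanSpace ℝ (Fin n)) :=
  {x | (‖x‖ : EReal) < R}

open Classical in
/-- The model metric `dr² + ξ(r)² dθ²` in Cartesian coordinates: the radial part of a vector keeps
its Euclidean length and its spherical part is scaled by `ξ(r)/r`; at the pole the metric is the
Euclidean one. -/
def modelMetric {n : ℕ} (ξ : ℝ → ℝ) (x v w : EuclideanSpace ℝ (Fin n)) : ℝ :=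
  if x = 0 then inner ℝ v w
  else inner ℝ x v * inner ℝ x w / ‖x‖ ^ 2
    + (ξ ‖x‖ / ‖x‖) ^ 2 * (inner ℝ v w - inner ℝ x v * inner ℝ x w / ‖x‖ ^ 2)

/-- The metric `g_P + e^{-2ψ(r)} ds²` of `M = P ×_{e^{-ψ}} ℝ`, at the point `p = (x, s)`. The Killing
field is `Y = ∂_s = (0, 1)`, with `|Y| = e^{-ψ}`. -/
def warpedMetric {n : ℕ} (ξ ψ : ℝ → ℝ) (p v w : EuclideanSpace ℝ (Fin n) × ℝ) : ℝ :=
  modelMetric ξ p.1 v.1 w.1 + Real.exp (-2 * ψ ‖p.1‖) * (v.2 * w.2)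

/-- The parametrization `x ↦ (x, u(|x|))` of the Killing graph of a radial function. -/
def radialGraphMap {n : ℕ} (u : ℝ → ℝ) (x : EuclideanSpace ℝ (Fin n)) :
    EuclideanSpace ℝ (Fin n) × ℝ :=
  (x, u ‖x‖)

/-- `A(r) = e^{-ψ(r)} ξ(r)^{n-1}`: the weighted area of the geodesic sphere of radius `r`, divided by
the area of the unit sphere. -/
def area (n : ℕ) (ξ ψ : ℝ → ℝ) (r : ℝ) : ℝ :=
  Real.exp (-ψ r) * ξ r ^ (n - 1)

/-- `V(r) = ∫₀ʳ e^{-ψ} ξ^{n-1}`: the weighted volume of the geodesic ball of radius `r`, divided by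
the area of the unit sphere. -/
def vol (n : ℕ) (ξ ψ : ℝ → ℝ) (r : ℝ) : ℝ :=
  ∫ τ in (0 : ℝ)..r, Real.exp (-ψ τ) * ξ τ ^ (n - 1)

/-- The integrand of the height function. -/
def heightIntegrand (n : ℕ) (ξ ψ : ℝ → ℝ) (H₀ τ : ℝ) : ℝ :=
  Real.exp (ψ τ) * (n * H₀ * vol n ξ ψ τ)
    / Real.sqrt (area n ξ ψ τ ^ 2 - n ^ 2 * H₀ ^ 2 * vol n ξ ψ τ ^ 2)

/-- The integrand of the height bound. -/
def boundIntegrand (n : ℕ) (ξ ψ : ℝ → ℝ) (H₀ τ : ℝ) : ℝ :=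
  -(n * H₀) / Real.sqrt (area n ξ ψ τ ^ 2 / vol n ξ ψ τ ^ 2 - n ^ 2 * H₀ ^ 2)

end KillingGraph

end

/-! Put `c = -n H₀` and `w = c V / A`. For a radial graph, set `w = -e^{-ψ}u' / √(1 + e^{-2ψ}u'²)`;
away from the pole, mean curvature `H₀` is the divergence equation `(A w)' = c A`. It is solved by
`A w = c V`, which gives `u' = -e^ψ w / √(1 - w²)`. The choice of `r₀` makes `w(r₀) = 1`. Since
`A/V` is non-increasing with nonzero derivative at `r₀`, one has `w < 1` before `r₀`, and `1 - w²`
has a simple zero there. Two places need care.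

At the pole, smoothness in `r` must become smoothness in `x`. If `f' = r k(r)` with `k(‖x‖)` smooth,
then `f(‖x‖)` has differential `k(‖x‖) ⟨x, ·⟩`, so it is smooth too. Together with averages `∫₀¹ sᵏ
f(s x) ds`, this yields `ξ = r e` (`IsModelWarping.exists_quotient`) and `V = r Q A`
(`exists_vol_eq_mul_area`), with `e` and `Q` smooth in `x`; hence `w = c r Q` and `u' = r k` with
`k` smooth.

At `r₀` the slope is infinite, but the substitution `r = r₀ - σ²` removes the singularity: `u =
Φ(√(r₀ - r))` with `Φ` smooth and `Φ'(0) > 0` (`exists_primitive_div_sqrt`). So the integral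
converges. Inverting `Φ` shows the graph near its boundary as `r = r₀ - Θ(s)²`, `s ≥ 0`
(`isHypersurfaceWithBoundary_radialGraph`).

For the curvature, both fundamental forms are combinations of the identity and `x xᵀ`, so the trace
is explicit and `curvature_identity` finishes. The pole, where the Christoffel symbols vanish, is
treated separately. -/

namespace KillingGraph
open Filter Topology

/-! ### Averages along rays in star-shaped open sets. -/

section ParametricIntegral

variable {E : Type} [NormedAddCommGroup E] [NormedSpace ℝ E]

theorem continuousOn_pow_smul_comp_smul {F : Type} [NormedAddCommGroup F] [NormedSpace ℝ F]
    {U : Set E} (hs : StarConvex ℝ 0 U) {f : E → F}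
    (hf : ContinuousOn f U) (k : ℕ) {x : E} (hx : x ∈ U) :
    ContinuousOn (fun s : ℝ => s ^ k • f (s • x)) (Icc 0 1) := by
  refine (continuous_pow k).continuousOn.smul (hf.comp (by fun_prop) ?_)
  intro s hs'
  exact hs.smul_mem hx hs'.1 hs'.2

theorem intervalIntegrable_pow_smul_comp_smul {F : Type} [NormedAddCommGroup F] [NormedSpace ℝ F]
    {U : Set E} (hs : StarConvex ℝ 0 U) {f : E → F}
    (hf : ContinuousOn f U) (k : ℕ) {x : E} (hx : x ∈ U) :
    IntervalIntegrable (fun s : ℝ => s ^ k • f (s • x)) volume 0 1 :=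
  ContinuousOn.intervalIntegrable_of_Icc zero_le_one (continuousOn_pow_smul_comp_smul hs hf k hx)

/-- The segments from `0` to a small closed ball sweep out a compact subset of `U`, so one constant
dominates the derivative. Differentiating raises the weight from `s ^ k` to `s ^ (k + 1)`, which is
why a general `k` is carried. -/
theorem hasFDerivAt_integral_pow_smul_comp_smul [ProperSpace E] {F : Type} [NormedAddCommGroup F] [NormedSpace ℝ F]
    {U : Set E} (hU : IsOpen U)
    (hs : StarConvex ℝ 0 U) {f : E → F} (hf : ContDiffOn ℝ 1 f U) (k : ℕ) {x : E} (hx : x ∈ U) :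
    HasFDerivAt (fun y => ∫ s in (0 : ℝ)..1, s ^ k • f (s • y))
      (∫ s in (0 : ℝ)..1, s ^ (k + 1) • fderiv ℝ f (s • x)) x := by
  obtain ⟨ε, hε, hball⟩ := Metric.nhds_basis_closedBall.mem_iff.1 (hU.mem_nhds hx)
  have hf' : ContinuousOn (fderiv ℝ f) U := hf.continuousOn_fderiv_of_isOpen hU le_rfl
  have hK : IsCompact ((fun p : ℝ × E => p.1 • p.2) '' (Icc 0 1 ×ˢ Metric.closedBall x ε)) :=
    (isCompact_Icc.prod (isCompact_closedBall x ε)).image (by fun_prop)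
  have hKU : (fun p : ℝ × E => p.1 • p.2) '' (Icc 0 1 ×ˢ Metric.closedBall x ε) ⊆ U := by
    rintro _ ⟨⟨s, y⟩, ⟨h1, h2⟩, rfl⟩
    exact hs.smul_mem (hball h2) h1.1 h1.2
  obtain ⟨C, hC⟩ := hK.exists_bound_of_continuousOn (hf'.mono hKU)
  refine intervalIntegral.hasFDerivAt_integral_of_dominated_of_fderiv_le (μ := volume)
    (F := fun y s => s ^ k • f (s • y)) (F' := fun y s => s ^ (k + 1) • fderiv ℝ f (s • y))
    (bound := fun _ => C) (s := Metric.ball x ε) (Metric.ball_mem_nhds x hε) ?_ ?_ ?_ ?_ ?_ ?_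
  · filter_upwards [hU.mem_nhds hx] with y hy
    have := (intervalIntegrable_pow_smul_comp_smul hs hf.continuousOn k hy).aestronglyMeasurable
    rwa [uIoc_of_le zero_le_one]
  · exact intervalIntegrable_pow_smul_comp_smul hs hf.continuousOn k hx
  · have := (intervalIntegrable_pow_smul_comp_smul hs hf' (k + 1) hx).aestronglyMeasurable
    rwa [uIoc_of_le zero_le_one]
  · refine Eventually.of_forall fun s hs1 y hy => ?_
    rw [uIoc_of_le zero_le_one] at hs1
    have h1 := hC (s • y) ⟨(s, y), ⟨⟨hs1.1.le, hs1.2⟩, Metric.ball_subset_closedBall hy⟩, rfl⟩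
    rw [norm_smul, norm_pow, Real.norm_of_nonneg hs1.1.le]
    calc s ^ (k + 1) * ‖fderiv ℝ f (s • y)‖ ≤ 1 * C :=
          mul_le_mul (pow_le_one₀ hs1.1.le hs1.2) h1 (norm_nonneg _) zero_le_one
      _ = C := one_mul C
  · exact intervalIntegrable_const
  · refine Eventually.of_forall fun s hs1 y hy => ?_
    rw [uIoc_of_le zero_le_one] at hs1
    have hy' : s • y ∈ U :=
      hs.smul_mem (hball (Metric.ball_subset_closedBall hy)) hs1.1.le hs1.2
    have h1 : HasFDerivAt f (fderiv ℝ f (s • y)) (s • y) :=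
      ((hf.differentiableOn one_ne_zero).differentiableAt (hU.mem_nhds hy')).hasFDerivAt
    have h2 : HasFDerivAt (fun z : E => s • z) (s • ContinuousLinearMap.id ℝ E) y :=
      (hasFDerivAt_id y).const_smul s
    have h3 := (h1.comp y h2).const_smul (s ^ k)
    refine HasFDerivAt.congr_fderiv (f := fun y : E => s ^ k • f (s • y)) h3 ?_
    ext v
    simp [pow_succ, mul_smul]

/-- The target `F` is quantified inside the induction because the step is applied to `fderiv ℝ f`,
which takes values in `E →L[ℝ] F`. -/
theorem contDiffOn_nat_integral_pow_smul_comp_smul [ProperSpace E] {U : Set E} (hU : IsOpen U)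
    (hs : StarConvex ℝ 0 U) (m : ℕ) : ∀ {F : Type} [NormedAddCommGroup F] [NormedSpace ℝ F]
    {f : E → F} (_ : ContDiffOn ℝ m f U) (k : ℕ),
    ContDiffOn ℝ m (fun x => ∫ s in (0 : ℝ)..1, s ^ k • f (s • x)) U := by
  induction m with
  | zero =>
    intro F _ _ f hf k
    simp only [CharP.cast_eq_zero, contDiffOn_zero] at hf ⊢
    intro x hx
    obtain ⟨ε, hε, hball⟩ := Metric.nhds_basis_closedBall.mem_iff.1 (hU.mem_nhds hx)
    have hK : IsCompact ((fun p : ℝ × E => p.1 • p.2) '' (Icc 0 1 ×ˢ Metric.closedBall x ε)) :=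
      (isCompact_Icc.prod (isCompact_closedBall x ε)).image (by fun_prop)
    have hKU : (fun p : ℝ × E => p.1 • p.2) '' (Icc 0 1 ×ˢ Metric.closedBall x ε) ⊆ U := by
      rintro _ ⟨⟨s, y⟩, ⟨h1, h2⟩, rfl⟩
      exact hs.smul_mem (hball h2) h1.1 h1.2
    obtain ⟨C, hC⟩ := hK.exists_bound_of_continuousOn (hf.mono hKU)
    refine ContinuousAt.continuousWithinAt
      (intervalIntegral.continuousAt_of_dominated_interval (bound := fun _ => C) ?_ ?_ ?_ ?_)
    · filter_upwards [hU.mem_nhds hx] with y hy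
      have := (intervalIntegrable_pow_smul_comp_smul hs hf k hy).aestronglyMeasurable
      rwa [uIoc_of_le zero_le_one]
    · filter_upwards [Metric.closedBall_mem_nhds x hε] with y hy
      refine Eventually.of_forall fun s hs1 => ?_
      rw [uIoc_of_le zero_le_one] at hs1
      have h1 := hC (s • y) ⟨(s, y), ⟨⟨hs1.1.le, hs1.2⟩, hy⟩, rfl⟩
      rw [norm_smul, norm_pow, Real.norm_of_nonneg hs1.1.le]
      calc s ^ k * ‖f (s • y)‖ ≤ 1 * C :=
            mul_le_mul (pow_le_one₀ hs1.1.le hs1.2) h1 (norm_nonneg _) zero_le_one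
        _ = C := one_mul C
    · exact intervalIntegrable_const
    · refine Eventually.of_forall fun s hs1 => ?_
      rw [uIoc_of_le zero_le_one] at hs1
      have hx' : s • x ∈ U := hs.smul_mem hx hs1.1.le hs1.2
      have h1 : ContinuousAt f (s • x) := hf.continuousAt (hU.mem_nhds hx')
      exact (ContinuousAt.comp (f := fun y : E => s • y) h1 (by fun_prop)).const_smul _
  | succ m ih =>
    intro F _ _ f hf k
    have hf1 : ContDiffOn ℝ 1 f U := hf.of_le (by exact_mod_cast Nat.succ_le_succ (Nat.zero_le m))
    have hd := fun x hx => hasFDerivAt_integral_pow_smul_comp_smul hU hs hf1 k (x := x) hx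
    push_cast at hf ⊢
    rw [contDiffOn_succ_iff_fderiv_of_isOpen hU] at hf ⊢
    refine ⟨fun x hx => (hd x hx).differentiableAt.differentiableWithinAt, by simp, ?_⟩
    exact (ih hf.2.2 (k + 1)).congr fun x hx => (hd x hx).fderiv

theorem contDiffOn_integral_pow_smul_comp_smul [ProperSpace E] {F : Type} [NormedAddCommGroup F] [NormedSpace ℝ F]
    {U : Set E} (hU : IsOpen U)
    (hs : StarConvex ℝ 0 U) {f : E → F} (hf : ContDiffOn ℝ ∞ f U) (k : ℕ) :
    ContDiffOn ℝ ∞ (fun x => ∫ s in (0 : ℝ)..1, s ^ k • f (s • x)) U := by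
  rw [contDiffOn_infty] at hf ⊢
  exact fun m => contDiffOn_nat_integral_pow_smul_comp_smul hU hs m (hf m) k

end ParametricIntegral

/-! ### Smoothness of radial functions at the pole. -/

section Radial

variable {E : Type} [NormedAddCommGroup E] [InnerProductSpace ℝ E]

/-- Writing the derivative as `‖x‖ * k` cancels the `1 / ‖x‖` in the gradient of the norm, leaving a
formula that also makes sense at `0`. -/
theorem hasFDerivAt_comp_norm {f : ℝ → ℝ} {k : ℝ} {x : E} (hx : x ≠ 0)
    (hf : HasDerivAt f (‖x‖ * k) ‖x‖) :
    HasFDerivAt (fun y : E => f ‖y‖) (k • innerSL ℝ x) x := by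
  have hx' : ‖x‖ ≠ 0 := norm_ne_zero_iff.2 hx
  have h1 : HasFDerivAt (fun y : E => ‖y‖ ^ 2) (2 • innerSL ℝ x) x :=
    (hasStrictFDerivAt_norm_sq x).hasFDerivAt
  have h2 := h1.sqrt (pow_ne_zero 2 hx')
  simp only [Real.sqrt_sq (norm_nonneg _)] at h2
  refine (hf.comp_hasFDerivAt x h2).congr_fderiv ?_
  ext v
  simp
  field_simp

theorem hasFDerivAt_comp_norm_zero {f : ℝ → ℝ} (hf : HasDerivWithinAt f 0 (Ici 0) 0) :
    HasFDerivAt (fun y : E => f ‖y‖) (0 : E →L[ℝ] ℝ) 0 := by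
  rw [hasDerivWithinAt_iff_isLittleO] at hf
  rw [hasFDerivAt_iff_isLittleO]
  have ht : Tendsto (fun y : E => ‖y‖) (𝓝 0) (𝓝[≥] 0) := by
    refine tendsto_nhdsWithin_iff.2 ⟨?_, Eventually.of_forall fun y => norm_nonneg y⟩
    simpa using (continuous_norm (E := E)).tendsto 0
  have := hf.comp_tendsto ht
  refine (this.congr (fun y => ?_) (fun y => ?_)).trans_isBigO
    (Asymptotics.isBigO_refl _ _).norm_left
  · simp
  · simp

theorem hasFDerivAt_comp_norm_of_lt {f k : ℝ → ℝ} (h0 : HasDerivWithinAt f 0 (Ici 0) 0)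
    {x : E} (h : 0 < ‖x‖ → HasDerivAt f (‖x‖ * k ‖x‖) ‖x‖) :
    HasFDerivAt (fun y : E => f ‖y‖) (k ‖x‖ • innerSL ℝ x) x := by
  rcases eq_or_ne x 0 with rfl | hx
  · simpa using hasFDerivAt_comp_norm_zero (E := E) h0
  · exact hasFDerivAt_comp_norm hx (h (norm_pos_iff.2 hx))

/-- The differential is `k ‖x‖ • innerSL ℝ x`, so `f` gains one derivative over `k`, across the pole
as well. -/
theorem contDiffOn_succ_comp_norm {U : Set E} (hU : IsOpen U) {m : ℕ} {f k : ℝ → ℝ}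
    (h0 : HasDerivWithinAt f 0 (Ici 0) 0)
    (h : ∀ x ∈ U, 0 < ‖x‖ → HasDerivAt f (‖x‖ * k ‖x‖) ‖x‖)
    (hk : ContDiffOn ℝ m (fun x : E => k ‖x‖) U) :
    ContDiffOn ℝ (m + 1) (fun x : E => f ‖x‖) U := by
  have hd := fun x hx => hasFDerivAt_comp_norm_of_lt (E := E) h0 (h x hx)
  rw [contDiffOn_succ_iff_fderiv_of_isOpen hU]
  refine ⟨fun x hx => (hd x hx).differentiableAt.differentiableWithinAt, by simp, ?_⟩
  exact (hk.smul (innerSL ℝ (E := E)).contDiff.contDiffOn).congr fun x hx => (hd x hx).fderiv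

theorem contDiffOn_infty_comp_norm {U : Set E} (hU : IsOpen U) {f k : ℝ → ℝ}
    (h0 : HasDerivWithinAt f 0 (Ici 0) 0)
    (h : ∀ x ∈ U, 0 < ‖x‖ → HasDerivAt f (‖x‖ * k ‖x‖) ‖x‖)
    (hk : ContDiffOn ℝ ∞ (fun x : E => k ‖x‖) U) :
    ContDiffOn ℝ ∞ (fun x : E => f ‖x‖) U := by
  rw [contDiffOn_infty] at hk ⊢
  intro m
  exact (contDiffOn_succ_comp_norm hU h0 h (hk m)).of_le (by exact_mod_cast Nat.le_succ m)

end Radial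

/-- The range `[0, R)` of the distance from the pole. -/
def radii (R : EReal) : Set ℝ := {r : ℝ | 0 ≤ r ∧ (r : EReal) < R}

/-! ### The interval of radii and the model ball. -/

section Domain

variable {R : EReal}

theorem radii_of_le {r t : ℝ} (hr : r ∈ radii R) (ht : 0 ≤ t) (htr : t ≤ r) : t ∈ radii R :=
  ⟨ht, (EReal.coe_le_coe_iff.2 htr).trans_lt hr.2⟩

theorem Icc_subset_radii {r : ℝ} (hr : r ∈ radii R) : Icc 0 r ⊆ radii R :=
  fun _ ht => radii_of_le hr ht.1 ht.2

theorem mul_mem_radii {r s : ℝ} (hr : r ∈ radii R) (hs : s ∈ Icc (0 : ℝ) 1) : s * r ∈ radii R :=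
  radii_of_le hr (mul_nonneg hs.1 hr.1) (mul_le_of_le_one_left hr.1 hs.2)

theorem isOpen_setOf_coe_lt : IsOpen {r : ℝ | (r : EReal) < R} :=
  isOpen_Iio.preimage continuous_coe_real_ereal

theorem radii_mem_nhds {r : ℝ} (hr : r ∈ radii R) (h0 : 0 < r) : radii R ∈ 𝓝 r :=
  inter_mem (Ici_mem_nhds h0) (isOpen_setOf_coe_lt.mem_nhds hr.2)

theorem radii_mem_nhdsGE (hR : 0 < R) : radii R ∈ 𝓝[≥] (0 : ℝ) :=
  inter_mem self_mem_nhdsWithin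
    (mem_nhdsWithin_of_mem_nhds (isOpen_setOf_coe_lt.mem_nhds (by simpa using hR)))

theorem zero_mem_radii (hR : 0 < R) : (0 : ℝ) ∈ radii R := ⟨le_rfl, by simpa using hR⟩

theorem convex_radii : Convex ℝ (radii R) := by
  refine Set.OrdConnected.convex ⟨fun a ha b hb t ht => radii_of_le hb (ha.1.trans ht.1) ht.2⟩

theorem uniqueDiffOn_radii (hR : 0 < R) : UniqueDiffOn ℝ (radii R) := by
  refine uniqueDiffOn_convex convex_radii ?_
  obtain ⟨r, hr0, hr⟩ := EReal.lt_iff_exists_real_btwn.1 hR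
  have hr0' : 0 < r := by exact_mod_cast hr0
  exact ⟨r, mem_interior_iff_mem_nhds.2 (radii_mem_nhds ⟨hr0'.le, hr⟩ hr0')⟩

theorem mem_modelBall_iff {n : ℕ} {x : EuclideanSpace ℝ (Fin n)} :
    x ∈ modelBall n R ↔ ‖x‖ ∈ radii R :=
  ⟨fun h => ⟨norm_nonneg x, h⟩, fun h => h.2⟩

theorem isOpen_modelBall {n : ℕ} : IsOpen (modelBall n R) :=
  isOpen_setOf_coe_lt.preimage continuous_norm

theorem norm_smul_of_mem_Icc {E : Type} [NormedAddCommGroup E] [NormedSpace ℝ E] {s : ℝ}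
    (hs : s ∈ Icc (0 : ℝ) 1) (x : E) : ‖s • x‖ = s * ‖x‖ := by
  rw [norm_smul, Real.norm_of_nonneg hs.1]

theorem starConvex_modelBall {n : ℕ} : StarConvex ℝ 0 (modelBall n R) := by
  rw [starConvex_zero_iff]
  intro x hx s hs0 hs1
  rw [mem_modelBall_iff, norm_smul_of_mem_Icc ⟨hs0, hs1⟩]
  exact mul_mem_radii (mem_modelBall_iff.1 hx) ⟨hs0, hs1⟩

end Domain

/-! ### Restriction of radial functions to a line through the pole. -/

section Restriction

variable {n : ℕ}

theorem exists_unit_vector (hn : 1 ≤ n) : ∃ e : EuclideanSpace ℝ (Fin n), ‖e‖ = 1 :=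
  ⟨EuclideanSpace.single ⟨0, hn⟩ 1, by simp⟩

theorem contDiffOn_abs_of_comp_norm (hn : 1 ≤ n) {U : Set ℝ} {f : ℝ → ℝ} {m : WithTop ℕ∞}
    (hf : ContDiffOn ℝ m (fun x : EuclideanSpace ℝ (Fin n) => f ‖x‖) {x | ‖x‖ ∈ U}) :
    ContDiffOn ℝ m (fun t : ℝ => f |t|) {t | |t| ∈ U} := by
  obtain ⟨e, he⟩ := exists_unit_vector hn
  have h := hf.comp (s := {t : ℝ | |t| ∈ U}) (f := fun t : ℝ => t • e)
    (by fun_prop) (by intro t ht; simpa [norm_smul, he] using ht)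
  refine h.congr fun t _ => ?_
  simp [norm_smul, he]

theorem contDiffOn_of_comp_norm (hn : 1 ≤ n) {R : EReal} {f : ℝ → ℝ} {m : WithTop ℕ∞}
    (hf : ContDiffOn ℝ m (fun x : EuclideanSpace ℝ (Fin n) => f ‖x‖) (modelBall n R)) :
    ContDiffOn ℝ m f (radii R) := by
  have h := contDiffOn_abs_of_comp_norm (U := radii R) hn
    (hf.mono fun x hx => mem_modelBall_iff.2 hx)
  refine (h.mono fun t ht => ?_).congr fun t ht => ?_
  · change |t| ∈ radii R
    rwa [abs_of_nonneg ht.1]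
  · rw [abs_of_nonneg ht.1]

end Restriction

/-! ### From vanishing odd or even derivatives at `0` to smooth functions of `x`. -/

section EvenJets

variable {R : EReal}

theorem mul_integral_derivWithin_mul (hR : 0 < R) {g : ℝ → ℝ} (hg : ContDiffOn ℝ ∞ g (radii R))
    {r : ℝ} (hr : r ∈ radii R) :
    r * ∫ s in (0 : ℝ)..1, s ^ 0 • derivWithin g (radii R) (s * r) = g r - g 0 := by
  have hc : ContinuousOn (derivWithin g (radii R)) (radii R) :=
    hg.continuousOn_derivWithin (uniqueDiffOn_radii hR) (by simp)
  have h1 : ∫ t in (0 : ℝ)..r, derivWithin g (radii R) t = g r - g 0 := by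
    refine intervalIntegral.integral_eq_sub_of_hasDerivAt_of_le hr.1
      (hg.continuousOn.mono (Icc_subset_radii hr)) (fun t ht => ?_)
      ((hc.mono (Icc_subset_radii hr)).intervalIntegrable_of_Icc hr.1)
    have ht' : t ∈ radii R := radii_of_le hr ht.1.le ht.2.le
    exact ((hg.differentiableOn (by simp)) t ht').hasDerivWithinAt.hasDerivAt
      (radii_mem_nhds ht' ht.1)
  rw [← h1]
  simp

/-- Since `η'(0) = 0`, `η'(r) = r ∫₀¹ η''(s r) ds`. The odd derivatives of `η''` vanish too, so by
induction `η''`, and with it the average, is `C^m` in `x`; then `contDiffOn_succ_comp_norm` adds one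
order. -/
theorem contDiffOn_nat_comp_norm_of_odd_deriv {n : ℕ} (hR : 0 < R) (m : ℕ) :
    ∀ {η : ℝ → ℝ} (_ : ContDiffOn ℝ ∞ η (radii R))
    (_ : ∀ k : ℕ, iteratedDerivWithin (2 * k + 1) η (radii R) 0 = 0),
    ContDiffOn ℝ m (fun x : EuclideanSpace ℝ (Fin n) => η ‖x‖) (modelBall n R) := by
  have hU := uniqueDiffOn_radii hR
  induction m with
  | zero =>
    intro η hη _
    rw [CharP.cast_eq_zero, contDiffOn_zero]
    exact hη.continuousOn.comp continuous_norm.continuousOn fun x hx => mem_modelBall_iff.1 hx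
  | succ m ih =>
    intro η hη h0
    have h1 : ContDiffOn ℝ ∞ (derivWithin η (radii R)) (radii R) := hη.derivWithin hU (by simp)
    have h2 : ContDiffOn ℝ ∞ (derivWithin (derivWithin η (radii R)) (radii R)) (radii R) :=
      h1.derivWithin hU (by simp)
    have hz : derivWithin η (radii R) 0 = 0 := by simpa [iteratedDerivWithin_one] using h0 0
    have hi := ih h2 fun k => by
      rw [← iteratedDerivWithin_succ', ← iteratedDerivWithin_succ']
      exact h0 (k + 1)
    push_cast
    refine contDiffOn_succ_comp_norm isOpen_modelBall (k := fun r =>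
      ∫ s in (0 : ℝ)..1, s ^ 0 • derivWithin (derivWithin η (radii R)) (radii R) (s * r))
      ?_ ?_ ?_
    · have := ((hη.differentiableOn (by simp)) 0 (zero_mem_radii hR)).hasDerivWithinAt
      rw [hz] at this
      exact this.mono_of_mem_nhdsWithin (radii_mem_nhdsGE hR)
    · intro x hx hx0
      have hx' := mem_modelBall_iff.1 hx
      rw [mul_integral_derivWithin_mul hR h1 hx', hz, sub_zero]
      exact ((hη.differentiableOn (by simp)) _ hx').hasDerivWithinAt.hasDerivAt
        (radii_mem_nhds hx' hx0)
    · refine (contDiffOn_nat_integral_pow_smul_comp_smul isOpen_modelBall starConvex_modelBall m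
        hi 0).congr fun x _ => ?_
      refine intervalIntegral.integral_congr fun s hs => ?_
      rw [uIcc_of_le zero_le_one] at hs
      simp only [norm_smul_of_mem_Icc hs]

theorem contDiffOn_integral_pow_smul_comp_norm {n : ℕ} {f : ℝ → ℝ}
    (hf : ContDiffOn ℝ ∞ (fun x : EuclideanSpace ℝ (Fin n) => f ‖x‖) (modelBall n R)) (k : ℕ) :
    ContDiffOn ℝ ∞ (fun x : EuclideanSpace ℝ (Fin n) =>
      ∫ s in (0 : ℝ)..1, s ^ k • f (s * ‖x‖)) (modelBall n R) := by
  refine (contDiffOn_integral_pow_smul_comp_smul isOpen_modelBall starConvex_modelBall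
    hf k).congr fun x _ => ?_
  refine intervalIntegral.integral_congr fun s hs => ?_
  rw [uIcc_of_le zero_le_one] at hs
  simp only [norm_smul_of_mem_Icc hs]

/-- The quotient `ξ / r` is the average of `ξ'` over `[0, r]`, and `ξ'` has vanishing odd
derivatives because `ξ` has vanishing even ones. -/
theorem IsModelWarping.exists_quotient {ξ : ℝ → ℝ} (hξ : IsModelWarping R ξ) (hR : 0 < R)
    (n : ℕ) : ∃ e : ℝ → ℝ,
      ContDiffOn ℝ ∞ (fun x : EuclideanSpace ℝ (Fin n) => e ‖x‖) (modelBall n R) ∧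
      e 0 = 1 ∧ (∀ r ∈ radii R, ξ r = r * e r) ∧ ∀ r ∈ radii R, 0 < e r := by
  have hs : ContDiffOn ℝ ∞ ξ (radii R) := hξ.smooth
  have h1 : ContDiffOn ℝ ∞ (derivWithin ξ (radii R)) (radii R) :=
    hs.derivWithin (uniqueDiffOn_radii hR) (by simp)
  have h0 : ξ 0 = 0 := by simpa using hξ.even_deriv 0
  have hmul : ∀ r ∈ radii R,
      ξ r = r * ∫ s in (0 : ℝ)..1, s ^ 0 • derivWithin ξ (radii R) (s * r) := fun r hr => by
    rw [mul_integral_derivWithin_mul hR hs hr, h0, sub_zero]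
  have he0 : ∫ s in (0 : ℝ)..1, s ^ 0 • derivWithin ξ (radii R) (s * 0) = 1 := by
    have h : derivWithin ξ (radii R) 0 = 1 := hξ.deriv_zero
    simpa using h
  refine ⟨fun r => ∫ s in (0 : ℝ)..1, s ^ 0 • derivWithin ξ (radii R) (s * r), ?_, he0, hmul, ?_⟩
  · refine contDiffOn_integral_pow_smul_comp_norm (contDiffOn_infty.2 fun m => ?_) 0
    refine contDiffOn_nat_comp_norm_of_odd_deriv hR m h1 fun k => ?_
    rw [← iteratedDerivWithin_succ']
    exact hξ.even_deriv (k + 1)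
  · intro r hr
    rcases hr.1.eq_or_lt with rfl | hr0
    · simp only [he0, zero_lt_one]
    · have := hξ.pos r hr0 hr.2
      rw [hmul r hr] at this
      exact pos_of_mul_pos_right this hr0.le

end EvenJets

/-! ### Weighted area and volume, and their quotient at the pole. -/

section Volume

variable {R : EReal} {n : ℕ} {ξ ψ : ℝ → ℝ}

theorem area_pos (hξ : IsModelWarping R ξ) {r : ℝ} (hr : r ∈ radii R) (h0 : 0 < r) :
    0 < area n ξ ψ r :=
  mul_pos (Real.exp_pos _) (pow_pos (hξ.pos r h0 hr.2) _)

theorem continuousOn_area (hξ : IsModelWarping R ξ) (hψ : ContinuousOn ψ (radii R)) :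
    ContinuousOn (area n ξ ψ) (radii R) :=
  hψ.neg.rexp.mul (ContinuousOn.pow (s := radii R) hξ.smooth.continuousOn _)

theorem hasDerivAt_vol (hξ : IsModelWarping R ξ) (hψ : ContinuousOn ψ (radii R)) {r : ℝ}
    (hr : r ∈ radii R) (h0 : 0 < r) : HasDerivAt (vol n ξ ψ) (area n ξ ψ r) r := by
  have hc := continuousOn_area (n := n) hξ hψ
  refine intervalIntegral.integral_hasDerivAt_right (f := area n ξ ψ)
    ((hc.mono (Icc_subset_radii hr)).intervalIntegrable_of_Icc hr.1) ?_
    (hc.continuousAt (radii_mem_nhds hr h0))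
  exact ContinuousOn.stronglyMeasurableAtFilter_nhdsWithin (s := radii R) hc
    (((measurableSet_Ici).inter isOpen_setOf_coe_lt.measurableSet)) r |>.filter_mono
      (by rw [nhdsWithin_eq_nhds.2 (radii_mem_nhds hr h0)])

theorem vol_pos (hξ : IsModelWarping R ξ) (hψ : ContinuousOn ψ (radii R)) {r : ℝ}
    (hr : r ∈ radii R) (h0 : 0 < r) : 0 < vol n ξ ψ r :=
  intervalIntegral.intervalIntegral_pos_of_pos_on (f := area n ξ ψ)
    (((continuousOn_area hξ hψ).mono (Icc_subset_radii hr)).intervalIntegrable_of_Icc hr.1)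
    (fun _ ht => area_pos hξ (radii_of_le hr ht.1.le ht.2.le) ht.1) h0

/-- With `A = r^(n-1) P`, rescaling `t = s r` gives `V = r^n ∫₀¹ s^(n-1) P(s r) ds`, and `P > 0` may
be divided out. The value `Q 0 = ∫₀¹ s^(n-1) ds` later gives the mean curvature at the pole. -/
theorem exists_vol_eq_mul_area (hn : 1 ≤ n) (hR : 0 < R) (hξ : IsModelWarping R ξ)
    (hψ : ContDiffOn ℝ ∞ (fun x : EuclideanSpace ℝ (Fin n) => ψ ‖x‖) (modelBall n R)) :
    ∃ Q : ℝ → ℝ, ContDiffOn ℝ ∞ (fun x : EuclideanSpace ℝ (Fin n) => Q ‖x‖) (modelBall n R) ∧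
      Q 0 = 1 / n ∧ ∀ r ∈ radii R, vol n ξ ψ r = r * Q r * area n ξ ψ r := by
  obtain ⟨e, he, he0, hmul, hepos⟩ := hξ.exists_quotient hR n
  set P : ℝ → ℝ := fun r => Real.exp (-ψ r) * e r ^ (n - 1) with hPdef
  have hPpos : ∀ r ∈ radii R, 0 < P r := fun r hr =>
    mul_pos (Real.exp_pos _) (pow_pos (hepos r hr) _)
  have hP : ContDiffOn ℝ ∞ (fun x : EuclideanSpace ℝ (Fin n) => P ‖x‖) (modelBall n R) :=
    hψ.neg.exp.mul (he.pow (n - 1))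
  have hA : ∀ r ∈ radii R, area n ξ ψ r = r ^ (n - 1) * P r := fun r hr => by
    rw [area, hmul r hr, mul_pow, hPdef]
    ring
  have hV : ∀ r ∈ radii R,
      vol n ξ ψ r = r ^ n * ∫ s in (0 : ℝ)..1, s ^ (n - 1) • P (s * r) := by
    intro r hr
    have h1 : vol n ξ ψ r = ∫ t in (0 : ℝ)..r, t ^ (n - 1) * P t := by
      refine intervalIntegral.integral_congr fun t ht => ?_
      rw [uIcc_of_le hr.1] at ht
      exact hA t (Icc_subset_radii hr ht)
    have h2 := intervalIntegral.smul_integral_comp_mul_right (a := 0) (b := 1)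
      (fun t => t ^ (n - 1) * P t) r
    simp only [zero_mul, one_mul] at h2
    rw [h1, ← h2, smul_eq_mul]
    obtain ⟨m, rfl⟩ : ∃ m, n = m + 1 := ⟨n - 1, by omega⟩
    simp only [Nat.add_sub_cancel, smul_eq_mul]
    rw [pow_succ', mul_assoc]
    simp only [mul_pow, mul_left_comm, mul_assoc, intervalIntegral.integral_const_mul]
  refine ⟨fun r => (∫ s in (0 : ℝ)..1, s ^ (n - 1) • P (s * r)) / P r, ?_, ?_, ?_⟩
  · exact (contDiffOn_integral_pow_smul_comp_norm hP (n - 1)).div hP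
      fun x hx => (hPpos _ (mem_modelBall_iff.1 hx)).ne'
  · have : P 0 ≠ 0 := (hPpos 0 (zero_mem_radii hR)).ne'
    have hn' : (n : ℝ) ≠ 0 := by exact_mod_cast (by omega : n ≠ 0)
    simp only [mul_zero, smul_eq_mul, intervalIntegral.integral_mul_const, integral_pow]
    rw [mul_div_assoc, div_self this]
    simp [Nat.cast_sub hn]
  · intro r hr
    have := (hPpos r hr).ne'
    rw [hV r hr, hA r hr]
    obtain ⟨m, rfl⟩ : ∃ m, n = m + 1 := ⟨n - 1, by omega⟩
    simp only [Nat.add_sub_cancel]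
    generalize ∫ s in (0 : ℝ)..1, s ^ m • P (s * r) = J
    field_simp
    ring

end Volume

/-! ### Square-root singularities and local inversion on the line. -/

section OneVariable

/-- Hadamard's lemma: `L` is the average of `D'` over the segment from `a` to `t`. -/
theorem exists_eq_sub_mul_of_eq_zero {U : Set ℝ} (hU : IsOpen U) (hc : Convex ℝ U) {a : ℝ}
    (ha : a ∈ U) {D : ℝ → ℝ} (hD : ContDiffOn ℝ ∞ D U) (h0 : D a = 0) :
    ∃ L : ℝ → ℝ, ContDiffOn ℝ ∞ L U ∧ (∀ t ∈ U, D t = (t - a) * L t) ∧ L a = deriv D a := by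
  have hd : ContDiffOn ℝ ∞ (deriv D) U := ((contDiffOn_infty_iff_deriv_of_isOpen hU).1 hD).2
  have hmem : ∀ t ∈ U, ∀ s ∈ Icc (0 : ℝ) 1, a + s * (t - a) ∈ U := fun t ht s hs => by
    have := hc.starConvex ha
    rw [starConvex_iff_segment_subset] at this
    refine this ht ?_
    rw [segment_eq_image']
    exact ⟨s, hs, rfl⟩
  have hV : IsOpen ((fun y => a + y) ⁻¹' U) := hU.preimage (by fun_prop)
  have hVs : StarConvex ℝ 0 ((fun y => a + y) ⁻¹' U) := by
    rw [starConvex_zero_iff]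
    intro y hy s hs0 hs1
    have := hmem (a + y) hy s ⟨hs0, hs1⟩
    simpa using this
  have hsm := contDiffOn_integral_pow_smul_comp_smul hV hVs
    (hd.comp (s := (fun y => a + y) ⁻¹' U) (f := fun y => a + y) (by fun_prop) fun y hy => hy) 0
  refine ⟨fun t => ∫ s in (0 : ℝ)..1, s ^ 0 • deriv D (a + s • (t - a)), ?_, ?_, ?_⟩
  · exact hsm.comp (s := U) (f := fun t => t - a) (by fun_prop) fun t ht => by simpa using ht
  · intro t ht
    have hco : ContinuousOn (fun s : ℝ => (t - a) * deriv D (a + s * (t - a))) (Icc 0 1) :=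
      continuousOn_const.mul (hd.continuousOn.comp (by fun_prop) fun s hs => hmem t ht s hs)
    have h1 : ∫ s in (0 : ℝ)..1, (t - a) * deriv D (a + s * (t - a)) = D t - D a := by
      have := intervalIntegral.integral_eq_sub_of_hasDerivAt_of_le zero_le_one
        (f := fun s => D (a + s * (t - a))) (f' := fun s => (t - a) * deriv D (a + s * (t - a)))
        (hD.continuousOn.comp (by fun_prop) fun s hs => hmem t ht s hs) (fun s hs => ?_)
        (hco.intervalIntegrable_of_Icc zero_le_one)
      · simpa using this
      · have hm := hmem t ht s (Ioo_subset_Icc_self hs)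
        have h2 : HasDerivAt D (deriv D (a + s * (t - a))) (a + s * (t - a)) :=
          ((hD.differentiableOn (by simp)).differentiableAt (hU.mem_nhds hm)).hasDerivAt
        have h3 : HasDerivAt (fun s : ℝ => a + s * (t - a)) (1 * (t - a)) s :=
          ((hasDerivAt_id s).mul_const (t - a)).const_add a
        refine (h2.comp s h3).congr_deriv ?_
        ring
    rw [h0, sub_zero] at h1
    rw [← h1, intervalIntegral.integral_const_mul]
    simp
  · simp

theorem hasDerivAt_integral_of_contDiffOn {J : Set ℝ} (hJ : IsOpen J) (hc : Convex ℝ J)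
    (h0 : (0 : ℝ) ∈ J) {f : ℝ → ℝ} (hf : ContinuousOn f J) {x : ℝ} (hx : x ∈ J) :
    HasDerivAt (fun y => ∫ t in (0 : ℝ)..y, f t) (f x) x := by
  refine intervalIntegral.integral_hasDerivAt_right ?_ ?_ (hf.continuousAt (hJ.mem_nhds hx))
  · exact (hf.mono (hc.ordConnected.uIcc_subset h0 hx)).intervalIntegrable
  · exact hf.stronglyMeasurableAtFilter hJ x hx

theorem contDiffOn_integral_of_contDiffOn {J : Set ℝ} (hJ : IsOpen J) (hc : Convex ℝ J)
    (h0 : (0 : ℝ) ∈ J) {f : ℝ → ℝ} (hf : ContDiffOn ℝ ∞ f J) :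
    ContDiffOn ℝ ∞ (fun y => ∫ t in (0 : ℝ)..y, f t) J := by
  have hd := fun x hx => hasDerivAt_integral_of_contDiffOn hJ hc h0 hf.continuousOn (x := x) hx
  rw [contDiffOn_infty_iff_deriv_of_isOpen hJ]
  exact ⟨fun x hx => (hd x hx).differentiableAt.differentiableWithinAt,
    hf.congr fun x hx => (hd x hx).deriv⟩

/-- The primitive of `-g / √D`, where `D` has a simple zero at `a`, is a smooth function of the
square root of the distance to `a`. -/
theorem exists_primitive_div_sqrt {U : Set ℝ} (hU : IsOpen U) (hc : Convex ℝ U) {a : ℝ}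
    (ha : 0 < a) (hUa : Ioc (-a) a ⊆ U) {D g : ℝ → ℝ} (hD : ContDiffOn ℝ ∞ D U)
    (hg : ContDiffOn ℝ ∞ g U) (hDa : D a = 0) (hD' : deriv D a < 0)
    (hDpos : ∀ t ∈ Ioo (-a) a, 0 < D t) (hga : 0 < g a) :
    ∃ (Φ : ℝ → ℝ) (J : Set ℝ), IsOpen J ∧ Icc 0 √a ⊆ J ∧ ContDiffOn ℝ ∞ Φ J ∧ Φ 0 = 0 ∧
      0 < deriv Φ 0 ∧
      ∀ r ∈ Ioo (-a) a, HasDerivAt (fun r => Φ √(a - r)) (-(g r / √(D r))) r := by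
  have haU : a ∈ U := hUa ⟨by linarith, le_rfl⟩
  obtain ⟨L, hL, hDL, hLa⟩ := exists_eq_sub_mul_of_eq_zero hU hc haU hD hDa
  have hLneg : ∀ t ∈ Ioc (-a) a, L t < 0 := by
    intro t ht
    rcases ht.2.eq_or_lt with rfl | hta
    · rwa [hLa]
    · have h1 := hDpos t ⟨ht.1, hta⟩
      rw [hDL t (hUa ht)] at h1
      by_contra! h2
      nlinarith [mul_nonneg (sub_nonneg.2 hta.le) h2]
  -- These are exactly the `σ` with `-a < a - σ²`. Negative `σ` are included so that `Φ` is smooth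
  -- on both sides of `0`.
  set J : Set ℝ := Ioo (-√(2 * a)) √(2 * a) with hJdef
  have hmem : ∀ σ, σ ∈ J ↔ σ ^ 2 < 2 * a := fun σ => by
    rw [hJdef, mem_Ioo, ← abs_lt, Real.lt_sqrt (abs_nonneg σ), sq_abs]
  have hJ0 : (0 : ℝ) ∈ J := by rw [hmem]; simpa using ha
  set W : Set ℝ := U ∩ L ⁻¹' (Iio 0) with hW
  have hmaps : ∀ σ ∈ J, a - σ ^ 2 ∈ W := fun σ hσ => by
    rw [hmem] at hσ
    have : a - σ ^ 2 ∈ Ioc (-a) a := ⟨by linarith, by nlinarith [sq_nonneg σ]⟩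
    exact ⟨hUa this, hLneg _ this⟩
  -- As `D r = (a - r)(-L r)`, the substitution `r = a - σ²`, `dr = -2σ dσ` cancels the factor `√(a
  -- - r) = σ` and leaves this smooth integrand.
  have hh : ContDiffOn ℝ ∞ (fun t => 2 * (g t / √(-L t))) W := by
    refine contDiffOn_const.mul ((hg.mono inter_subset_left).div
      ((hL.mono inter_subset_left).neg.sqrt fun t ht => ?_) fun t ht => ?_)
    · exact (neg_pos.2 ht.2).ne'
    · exact (Real.sqrt_pos.2 (neg_pos.2 ht.2)).ne'
  have hf : ContDiffOn ℝ ∞ (fun σ : ℝ => 2 * (g (a - σ ^ 2) / √(-L (a - σ ^ 2)))) J :=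
    hh.comp (f := fun σ : ℝ => a - σ ^ 2) (by fun_prop) hmaps
  have hJc : Convex ℝ J := convex_Ioo _ _
  have hd := fun x hx => hasDerivAt_integral_of_contDiffOn isOpen_Ioo hJc hJ0 hf.continuousOn
    (x := x) hx
  refine ⟨fun y => ∫ σ in (0 : ℝ)..y, 2 * (g (a - σ ^ 2) / √(-L (a - σ ^ 2))), J, isOpen_Ioo, ?_,
    contDiffOn_integral_of_contDiffOn isOpen_Ioo hJc hJ0 hf, by simp, ?_, ?_⟩
  · intro σ hσ
    rw [hmem]
    have := Real.sq_sqrt ha.le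
    nlinarith [hσ.1, hσ.2, Real.sqrt_nonneg a]
  · rw [(hd 0 hJ0).deriv]
    have := hLneg a ⟨by linarith, le_rfl⟩
    simp only [ne_eq, OfNat.ofNat_ne_zero, not_false_eq_true, zero_pow, sub_zero]
    exact mul_pos two_pos (div_pos hga (Real.sqrt_pos.2 (neg_pos.2 this)))
  · intro r hr
    have hpos : 0 < a - r := sub_pos.2 hr.2
    have hsq := Real.sq_sqrt hpos.le
    have hJr : √(a - r) ∈ J := by rw [hmem, hsq]; linarith [hr.1]
    have h1 : HasDerivAt (fun r => √(a - r)) (-1 / (2 * √(a - r))) r :=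
      ((hasDerivAt_id r).const_sub a).sqrt hpos.ne'
    refine ((hd _ hJr).comp r h1).congr_deriv ?_
    have hr' : r ∈ Ioc (-a) a := Ioo_subset_Ioc_self hr
    have hDr : √(D r) = √(a - r) * √(-L r) := by
      rw [hDL r (hUa hr'), ← Real.sqrt_mul hpos.le]
      congr 1
      ring
    rw [hsq, sub_sub_cancel, hDr]
    have h2 := (Real.sqrt_pos.2 hpos).ne'
    have h3 := (Real.sqrt_pos.2 (neg_pos.2 (hLneg r hr'))).ne'
    field_simp

/-- A smooth local inverse near `0`, with a one-sided description. -/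
theorem exists_smooth_local_inverse {Φ : ℝ → ℝ} {J : Set ℝ} (hJ : IsOpen J) (h0J : (0 : ℝ) ∈ J)
    (hΦ : ContDiffOn ℝ ∞ Φ J) (h0 : Φ 0 = 0) (hd : 0 < deriv Φ 0) :
    ∃ (Θ : ℝ → ℝ) (V : Set ℝ) (δ : ℝ), IsOpen V ∧ 0 < δ ∧ ContDiffOn ℝ ∞ Θ V ∧
      (∀ s ∈ V, Φ (Θ s) = s ∧ (0 ≤ Θ s ↔ 0 ≤ s)) ∧ ∀ σ, |σ| < δ → Φ σ ∈ V ∧ Θ (Φ σ) = σ := by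
  have hΦ' : ContDiffOn ℝ ∞ (deriv Φ) J := ((contDiffOn_infty_iff_deriv_of_isOpen hJ).1 hΦ).2
  have hat : ContDiffAt ℝ ∞ Φ 0 := hΦ.contDiffAt (hJ.mem_nhds h0J)
  have hD := ((hat.differentiableAt (by simp)).hasDerivAt).hasFDerivAt_equiv hd.ne'
  set e := hat.toOpenPartialHomeomorph Φ hD (by simp) with he
  have hecoe : ⇑e = Φ := hat.toOpenPartialHomeomorph_coe hD (by simp)
  have hsrc : (0 : ℝ) ∈ e.source := hat.mem_toOpenPartialHomeomorph_source hD (by simp)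
  have hopen : IsOpen (e.source ∩ (J ∩ deriv Φ ⁻¹' Ioi 0)) :=
    e.open_source.inter (hΦ'.continuousOn.isOpen_inter_preimage hJ isOpen_Ioi)
  obtain ⟨δ, hδ, hball⟩ := Metric.isOpen_iff.1 hopen 0 ⟨hsrc, h0J, hd⟩
  have hball' : ∀ σ ∈ Ioo (-δ) δ, σ ∈ e.source ∩ (J ∩ deriv Φ ⁻¹' Ioi 0) := fun σ hσ => by
    refine hball ?_
    rw [Metric.mem_ball, Real.dist_eq, sub_zero]
    exact abs_lt.2 hσ
  -- Monotonicity is what makes the inverse preserve the sign, so that `s ≥ 0` can replace `σ ≥ 0`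
  -- as the one-sided condition.
  have hmono : StrictMonoOn Φ (Ioo (-δ) δ) := by
    refine strictMonoOn_of_deriv_pos (convex_Ioo _ _)
      (hΦ.continuousOn.mono fun σ hσ => (hball' σ hσ).2.1) fun σ hσ => ?_
    rw [interior_Ioo] at hσ
    exact (hball' σ hσ).2.2
  refine ⟨e.symm, e.target ∩ e.symm ⁻¹' Ioo (-δ) δ, δ, e.isOpen_inter_preimage_symm isOpen_Ioo,
    hδ, ?_, ?_, ?_⟩
  · intro s hs
    have hs' := hball' _ hs.2
    refine (e.contDiffAt_symm_deriv hs'.2.2.ne' hs.1 ?_ ?_).contDiffWithinAt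
    · rw [hecoe]
      exact ((hΦ.differentiableOn (by simp)).differentiableAt (hJ.mem_nhds hs'.2.1)).hasDerivAt
    · rw [hecoe]
      exact hΦ.contDiffAt (hJ.mem_nhds hs'.2.1)
  · intro s hs
    have h1 : Φ (e.symm s) = s := by rw [← hecoe]; exact e.right_inv hs.1
    refine ⟨h1, ?_⟩
    have h2 := hmono.le_iff_le (a := 0) (b := e.symm s) ⟨by linarith, hδ⟩ hs.2
    rw [h0, h1] at h2
    exact h2.symm
  · intro σ hσ
    have hσ' : σ ∈ Ioo (-δ) δ := abs_lt.1 hσ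
    have hs := hball' σ hσ'
    have h1 : e.symm (Φ σ) = σ := by rw [← hecoe]; exact e.left_inv hs.1
    refine ⟨⟨?_, ?_⟩, h1⟩
    · rw [← hecoe]; exact e.map_source hs.1
    · rw [mem_preimage, h1]; exact hσ'

end OneVariable

/-! ### The graph as a hypersurface with boundary. -/

section Hypersurface

variable {n : ℕ}

theorem mem_radialGraph_iff {u : ℝ → ℝ} {a : ℝ} {p : EuclideanSpace ℝ (Fin n) × ℝ} :
    p ∈ radialGraphMap u '' {x : EuclideanSpace ℝ (Fin n) | ‖x‖ ≤ a} ↔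
      ‖p.1‖ ≤ a ∧ p.2 = u ‖p.1‖ := by
  constructor
  · rintro ⟨x, hx, rfl⟩
    exact ⟨hx, rfl⟩
  · rintro ⟨h1, h2⟩
    exact ⟨p.1, h1, Prod.ext rfl h2.symm⟩

/-- In the interior, `s - u(‖x‖)` is a defining function. It is not smooth at the boundary, so there
`s = Φ(√(a - ‖x‖))` is solved for the radius: `‖x‖ = a - Θ(s)²`, the condition `s ≥ 0` selecting the
root `σ ≥ 0`. -/
theorem isHypersurfaceWithBoundary_radialGraph {u Φ : ℝ → ℝ} {a : ℝ} (ha : 0 < a) {J : Set ℝ}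
    (hJ : IsOpen J) (h0J : (0 : ℝ) ∈ J) (hΦ : ContDiffOn ℝ ∞ Φ J) (h0 : Φ 0 = 0)
    (hd : 0 < deriv Φ 0) (hu : ∀ r ∈ Icc 0 a, u r = Φ √(a - r))
    (hsm : ContDiffOn ℝ ∞ (fun x : EuclideanSpace ℝ (Fin n) => u ‖x‖) {x | ‖x‖ < a}) :
    IsHypersurfaceWithBoundary
      (radialGraphMap u '' {x : EuclideanSpace ℝ (Fin n) | ‖x‖ ≤ a})
      {p | ‖p.1‖ = a ∧ p.2 = 0} := by
  have hua : u a = 0 := by rw [hu a ⟨ha.le, le_rfl⟩, sub_self, Real.sqrt_zero, h0]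
  refine ⟨?_, ?_, ?_⟩
  · rintro p ⟨h1, h2⟩
    exact mem_radialGraph_iff.2 ⟨h1.le, by rw [h1, h2, hua]⟩
  · rintro p ⟨hp, hpB⟩
    rw [mem_radialGraph_iff] at hp
    have hlt : ‖p.1‖ < a := by
      refine lt_of_le_of_ne hp.1 fun h => hpB ⟨h, ?_⟩
      rw [hp.2, h, hua]
    have hopen : IsOpen {x : EuclideanSpace ℝ (Fin n) | ‖x‖ < a} :=
      isOpen_lt continuous_norm continuous_const
    refine ⟨{q | ‖q.1‖ < a}, hopen.preimage continuous_fst, hlt,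
      fun q => q.2 - u ‖q.1‖, ?_, ?_, ?_⟩
    · exact contDiffOn_snd.sub (hsm.comp (f := Prod.fst) contDiffOn_fst fun q hq => hq)
    · have h1 : DifferentiableAt ℝ (fun x : EuclideanSpace ℝ (Fin n) => u ‖x‖) p.1 :=
        (hsm.differentiableOn (by simp)).differentiableAt (hopen.mem_nhds hlt)
      have h2 := hasFDerivAt_snd (𝕜 := ℝ) (p := p) |>.sub
        (h1.hasFDerivAt.comp p hasFDerivAt_fst)
      intro h3
      have h4 := congrArg (fun T => T ((0 : EuclideanSpace ℝ (Fin n)), (1 : ℝ)))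
        (h2.fderiv.symm.trans h3)
      simp at h4
    · ext q
      simp only [mem_inter_iff, mem_radialGraph_iff, mem_ofPred_eq, sub_eq_zero]
      exact ⟨fun h => ⟨h.2, h.1.2⟩, fun h => ⟨⟨h.1.le, h.2⟩, h.1⟩⟩
  · rintro p ⟨hp1, hp2⟩
    obtain ⟨Θ, V, δ, hV, hδ, hΘ, hΘinv, hΦinv⟩ := exists_smooth_local_inverse hJ h0J hΦ h0 hd
    have h0V : (0 : ℝ) ∈ V ∧ Θ 0 = 0 := by
      have := hΦinv 0 (by simpa using hδ)
      rwa [h0] at this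
    have hp0 : p.1 ≠ 0 := by
      rw [← norm_pos_iff, hp1]; exact ha
    -- The norm is smooth away from `0`, and `a - ‖x‖ < δ²` puts `√(a - ‖x‖)` where `Θ` inverts `Φ`.
    refine ⟨{q | (‖q.1‖ ≠ 0 ∧ a - ‖q.1‖ < δ ^ 2) ∧ q.2 ∈ V}, ?_, ?_,
      fun q => ‖q.1‖ - a + Θ q.2 ^ 2, fun q => q.2, ?_, ?_, ?_, ?_, ?_⟩
    · refine IsOpen.inter (IsOpen.inter ?_ ?_) (hV.preimage continuous_snd)
      · exact isOpen_ne_fun continuous_fst.norm continuous_const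
      · exact isOpen_lt (continuous_const.sub continuous_fst.norm) continuous_const
    · refine ⟨⟨by rw [hp1]; exact ha.ne', ?_⟩, by rw [hp2]; exact h0V.1⟩
      rw [hp1, sub_self]
      positivity
    · refine (ContDiffOn.sub ?_ contDiffOn_const).add
        ((hΘ.comp (f := Prod.snd) contDiffOn_snd fun q hq => hq.2).pow 2)
      exact contDiffOn_fst.norm ℝ fun q hq => norm_ne_zero_iff.1 hq.1.1
    · exact contDiffOn_snd
    · have hΘd : HasDerivAt Θ (deriv Θ 0) p.2 := by
        rw [hp2]
        exact ((hΘ.differentiableOn (by simp)).differentiableAt (hV.mem_nhds h0V.1)).hasDerivAt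
      have hn : HasFDerivAt (fun x : EuclideanSpace ℝ (Fin n) => ‖x‖) (a⁻¹ • innerSL ℝ p.1) p.1 :=
        hasFDerivAt_comp_norm (f := fun r => r) hp0
          (by rw [hp1, mul_inv_cancel₀ ha.ne']; exact hasDerivAt_id _)
      have h1 := ((hn.comp p hasFDerivAt_fst).sub_const a).add
        ((hΘd.comp_hasFDerivAt p (hasFDerivAt_snd (𝕜 := ℝ) (p := p))).pow 2)
      -- As `Θ 0 = 0`, the square contributes nothing: one differential is purely radial, the other
      -- purely vertical.
      have h1' : fderiv ℝ (fun q : EuclideanSpace ℝ (Fin n) × ℝ => ‖q.1‖ - a + Θ q.2 ^ 2) p =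
          (a⁻¹ • innerSL ℝ p.1).comp (ContinuousLinearMap.fst ℝ _ ℝ) := by
        refine HasFDerivAt.fderiv (h1.congr_fderiv ?_)
        ext v <;> simp [hp2, h0V.2]
      have h2 : fderiv ℝ (fun q : EuclideanSpace ℝ (Fin n) × ℝ => q.2) p =
          ContinuousLinearMap.snd ℝ _ ℝ := fderiv_snd
      rw [h1', h2, LinearIndependent.pair_iff]
      intro s t hst
      have hs := congrArg (fun T => T (p.1, (0 : ℝ))) hst
      have ht := congrArg (fun T => T ((0 : EuclideanSpace ℝ (Fin n)), (1 : ℝ))) hst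
      simp [ha.ne', hp0] at hs
      simp at ht
      exact ⟨hs, ht⟩
    · ext q
      simp only [mem_inter_iff, mem_radialGraph_iff, mem_ofPred_eq]
      constructor
      · rintro ⟨⟨hq1, hq2⟩, ⟨hq0, hqδ⟩, hqV⟩
        have hnn : 0 ≤ a - ‖q.1‖ := sub_nonneg.2 hq1
        rw [hu _ ⟨norm_nonneg _, hq1⟩] at hq2
        have h1 := hΦinv √(a - ‖q.1‖) (by
          rwa [abs_of_nonneg (Real.sqrt_nonneg _), Real.sqrt_lt' hδ])
        rw [← hq2] at h1
        refine ⟨⟨⟨hq0, hqδ⟩, hqV⟩, ?_, ?_⟩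
        · rw [h1.2, Real.sq_sqrt hnn]; ring
        · rw [← (hΘinv _ hqV).2, h1.2]; exact Real.sqrt_nonneg _
      · rintro ⟨⟨⟨hq0, hqδ⟩, hqV⟩, hf, hg⟩
        have h1 : a - ‖q.1‖ = Θ q.2 ^ 2 := by linarith
        have hle : ‖q.1‖ ≤ a := by nlinarith [sq_nonneg (Θ q.2)]
        refine ⟨⟨hle, ?_⟩, ⟨hq0, hqδ⟩, hqV⟩
        rw [hu _ ⟨norm_nonneg _, hle⟩, h1, Real.sqrt_sq ((hΘinv _ hqV).2.2 hg), (hΘinv _ hqV).1]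
    · ext q
      simp only [mem_inter_iff, mem_ofPred_eq]
      constructor
      · rintro ⟨⟨h1, h2⟩, h3⟩
        refine ⟨h3, ?_, h2⟩
        rw [h1, h2, h0V.2]; ring
      · rintro ⟨h3, h1, h2⟩
        refine ⟨⟨?_, h2⟩, h3⟩
        rw [h2, h0V.2] at h1
        linarith

end Hypersurface

/-! ### Mean curvature from rotationally symmetric fundamental forms. -/

section Trace

/-- Trace of `A⁻¹ B` for two matrices of the form `a • 1 + b • x xᵀ`. -/
theorem trace_inv_mul_rank_one {n : ℕ} (x : Fin n → ℝ) {a b α β ρ : ℝ} (hρ : ∑ i, x i * x i = ρ)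
    (ha : a ≠ 0) (hab : a + b * ρ ≠ 0) :
    Matrix.trace ((a • (1 : Matrix (Fin n) (Fin n) ℝ) + b • Matrix.vecMulVec x x)⁻¹ *
      (α • (1 : Matrix (Fin n) (Fin n) ℝ) + β • Matrix.vecMulVec x x)) =
      (n - 1) * (α / a) + (α + β * ρ) / (a + b * ρ) := by
  have hdot : x ⬝ᵥ x = ρ := hρ
  have hvv : Matrix.vecMulVec x x * Matrix.vecMulVec x x = ρ • Matrix.vecMulVec x x := by
    rw [Matrix.vecMulVec_mul_vecMulVec, hdot, Matrix.vecMulVec_smul]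
  -- The Sherman–Morrison formula.
  have hinv : (a • (1 : Matrix (Fin n) (Fin n) ℝ) + b • Matrix.vecMulVec x x)⁻¹ =
      a⁻¹ • (1 : Matrix (Fin n) (Fin n) ℝ) -
        (b / (a * (a + b * ρ))) • Matrix.vecMulVec x x := by
    refine Matrix.inv_eq_right_inv ?_
    have h : (a • (1 : Matrix (Fin n) (Fin n) ℝ) + b • Matrix.vecMulVec x x) *
        (a⁻¹ • (1 : Matrix (Fin n) (Fin n) ℝ) -
          (b / (a * (a + b * ρ))) • Matrix.vecMulVec x x) =
        (a * a⁻¹) • (1 : Matrix (Fin n) (Fin n) ℝ) +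
          (b * a⁻¹ - (a + b * ρ) * (b / (a * (a + b * ρ)))) • Matrix.vecMulVec x x := by
      simp only [add_mul, mul_sub, smul_mul_assoc, mul_smul_comm, one_mul, mul_one, hvv]
      module
    rw [h, mul_inv_cancel₀ ha]
    have : b * a⁻¹ - (a + b * ρ) * (b / (a * (a + b * ρ))) = 0 := by
      field_simp
      ring
    rw [this, zero_smul, add_zero, one_smul]
  have htr : Matrix.trace (Matrix.vecMulVec x x) = ρ := by
    rw [Matrix.trace_vecMulVec, hdot]
  have hprod : (a⁻¹ • (1 : Matrix (Fin n) (Fin n) ℝ) -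
        (b / (a * (a + b * ρ))) • Matrix.vecMulVec x x) *
      (α • (1 : Matrix (Fin n) (Fin n) ℝ) + β • Matrix.vecMulVec x x) =
      (a⁻¹ * α) • (1 : Matrix (Fin n) (Fin n) ℝ) +
        (a⁻¹ * β - (b / (a * (a + b * ρ))) * (α + β * ρ)) • Matrix.vecMulVec x x := by
    simp only [sub_mul, mul_add, smul_mul_assoc, mul_smul_comm, one_mul, mul_one, hvv]
    module
  rw [hinv, hprod, Matrix.trace_add, Matrix.trace_smul, Matrix.trace_smul, htr, Matrix.trace_one,
    Fintype.card_fin, smul_eq_mul, smul_eq_mul]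
  field_simp
  ring

variable {n : ℕ}

theorem inner_single_single (i j : Fin n) :
    inner ℝ (EuclideanSpace.single i (1 : ℝ)) (EuclideanSpace.single j (1 : ℝ)) =
      (1 : Matrix (Fin n) (Fin n) ℝ) i j := by
  rw [EuclideanSpace.inner_single_left, Matrix.one_apply]
  simp

theorem inner_single_one (x : EuclideanSpace ℝ (Fin n)) (i : Fin n) :
    inner ℝ x (EuclideanSpace.single i (1 : ℝ)) = x i := by
  rw [EuclideanSpace.inner_single_right]
  simp

/-- The `n - 1` directions orthogonal to `x` contribute `α / a` each; the other term is the radial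
direction. -/
theorem meanCurvature_eq_of_forms {G : EuclideanSpace ℝ (Fin n) × ℝ → EuclideanSpace ℝ (Fin n) × ℝ →
    EuclideanSpace ℝ (Fin n) × ℝ → ℝ}
    {X : EuclideanSpace ℝ (Fin n) → EuclideanSpace ℝ (Fin n) × ℝ}
    {N : EuclideanSpace ℝ (Fin n) × ℝ} {x : EuclideanSpace ℝ (Fin n)}
    {a b α β : ℝ} (ha : a ≠ 0) (hab : a + b * ‖x‖ ^ 2 ≠ 0)
    (h1 : ∀ v w, firstForm G X x v w = a * inner ℝ v w + b * (inner ℝ x v * inner ℝ x w))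
    (h2 : ∀ v w, secondForm G X N x v w = α * inner ℝ v w + β * (inner ℝ x v * inner ℝ x w)) :
    meanCurvature G X N x = (1 / (n : ℝ)) *
      ((n - 1) * (α / a) + (α + β * ‖x‖ ^ 2) / (a + b * ‖x‖ ^ 2)) := by
  have hρ : ∑ i, x i * x i = ‖x‖ ^ 2 := by
    rw [EuclideanSpace.norm_sq_eq]
    simp [sq]
  rw [meanCurvature, ← trace_inv_mul_rank_one x hρ ha hab]
  congr 4
  · ext i j
    rw [Matrix.of_apply, h1, inner_single_single]
    simp only [inner_single_one, Matrix.add_apply, Matrix.smul_apply, smul_eq_mul,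
      Matrix.vecMulVec_apply]
  · ext i j
    rw [Matrix.of_apply, h2, inner_single_single]
    simp only [inner_single_one, Matrix.add_apply, Matrix.smul_apply, smul_eq_mul,
      Matrix.vecMulVec_apply]

theorem meanCurvature_eq_of_forms_zero
    {G : EuclideanSpace ℝ (Fin n) × ℝ → EuclideanSpace ℝ (Fin n) × ℝ →
    EuclideanSpace ℝ (Fin n) × ℝ → ℝ}
    {X : EuclideanSpace ℝ (Fin n) → EuclideanSpace ℝ (Fin n) × ℝ}
    {N : EuclideanSpace ℝ (Fin n) × ℝ} {x : EuclideanSpace ℝ (Fin n)} {α : ℝ} (hn : 1 ≤ n)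
    (h1 : ∀ v w, firstForm G X x v w = inner ℝ v w)
    (h2 : ∀ v w, secondForm G X N x v w = α * inner ℝ v w) :
    meanCurvature G X N x = α := by
  have e1 : (Matrix.of fun i j : Fin n =>
      firstForm G X x (EuclideanSpace.single i 1) (EuclideanSpace.single j 1)) = 1 := by
    ext i j
    simp [h1, inner_single_single]
  have e2 : (Matrix.of fun i j : Fin n =>
      secondForm G X N x (EuclideanSpace.single i 1) (EuclideanSpace.single j 1)) =
      α • (1 : Matrix (Fin n) (Fin n) ℝ) := by
    ext i j
    simp [h2, inner_single_single]
  have hn' : (n : ℝ) ≠ 0 := by exact_mod_cast (by omega : n ≠ 0)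
  rw [meanCurvature, e1, e2, inv_one, one_mul, Matrix.trace_smul, Matrix.trace_one,
    Fintype.card_fin, smul_eq_mul]
  field_simp

end Trace

/-! ### First and second derivatives of the graph map. -/

section Graph

variable {n : ℕ} {u k : ℝ → ℝ} {x : EuclideanSpace ℝ (Fin n)}

theorem fderiv_radialGraphMap {L : EuclideanSpace ℝ (Fin n) →L[ℝ] ℝ}
    (h : HasFDerivAt (fun y : EuclideanSpace ℝ (Fin n) => u ‖y‖) L x) :
    fderiv ℝ (radialGraphMap u) x = ContinuousLinearMap.inl ℝ _ ℝ +
      (ContinuousLinearMap.inr ℝ (EuclideanSpace ℝ (Fin n)) ℝ).comp L := by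
  refine HasFDerivAt.fderiv (HasFDerivAt.congr_fderiv ((hasFDerivAt_id x).prodMk h) ?_)
  ext v <;> simp

theorem fderiv_radialGraphMap_apply
    (h : HasFDerivAt (fun y : EuclideanSpace ℝ (Fin n) => u ‖y‖) (k ‖x‖ • innerSL ℝ x) x)
    (v : EuclideanSpace ℝ (Fin n)) :
    fderiv ℝ (radialGraphMap u) x v = (v, k ‖x‖ * inner ℝ x v) := by
  rw [fderiv_radialGraphMap h]
  simp

theorem fderiv_fderiv_radialGraphMap_apply
    (h : ∀ᶠ y in 𝓝 x,
      HasFDerivAt (fun y : EuclideanSpace ℝ (Fin n) => u ‖y‖) (k ‖y‖ • innerSL ℝ y) y)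
    {L : EuclideanSpace ℝ (Fin n) →L[ℝ] ℝ}
    (hk : HasFDerivAt (fun y : EuclideanSpace ℝ (Fin n) => k ‖y‖) L x)
    (v w : EuclideanSpace ℝ (Fin n)) :
    fderiv ℝ (fderiv ℝ (radialGraphMap u)) x v w =
      (0, L v * inner ℝ x w + k ‖x‖ * inner ℝ v w) := by
  have h1 : fderiv ℝ (radialGraphMap (n := n) u) =ᶠ[𝓝 x] fun y => ContinuousLinearMap.inl ℝ _ ℝ +
      ContinuousLinearMap.compL ℝ (EuclideanSpace ℝ (Fin n)) ℝ (EuclideanSpace ℝ (Fin n) × ℝ)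
        (ContinuousLinearMap.inr ℝ (EuclideanSpace ℝ (Fin n)) ℝ) (k ‖y‖ • innerSL ℝ y) := by
    filter_upwards [h] with y hy
    exact fderiv_radialGraphMap hy
  have h2 := hk.smul (innerSL ℝ (E := EuclideanSpace ℝ (Fin n))).hasFDerivAt
  have h3 := ((ContinuousLinearMap.compL ℝ (EuclideanSpace ℝ (Fin n)) ℝ
    (EuclideanSpace ℝ (Fin n) × ℝ) (ContinuousLinearMap.inr ℝ (EuclideanSpace ℝ (Fin n)) ℝ))
    |>.hasFDerivAt.comp x h2).const_add (ContinuousLinearMap.inl ℝ _ ℝ)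
  rw [(h3.congr_of_eventuallyEq h1).fderiv]
  simp [innerSL_apply_apply ℝ]
  ring

end Graph

/-! ### Derivatives of the warped metric, away from the pole and at it. -/

section Metric

variable {n : ℕ} {ξ ψ : ℝ → ℝ} {x : EuclideanSpace ℝ (Fin n)}

theorem warpedMetric_of_ne_zero (hx : x ≠ 0) (s : ℝ) (V W : EuclideanSpace ℝ (Fin n) × ℝ) :
    warpedMetric ξ ψ (x, s) V W = (ξ ‖x‖ / ‖x‖) ^ 2 * inner ℝ V.1 W.1 +
      (1 - (ξ ‖x‖ / ‖x‖) ^ 2) / ‖x‖ ^ 2 * (inner ℝ x V.1 * inner ℝ x W.1) +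
      Real.exp (-2 * ψ ‖x‖) * (V.2 * W.2) := by
  simp only [warpedMetric, modelMetric, if_neg hx]
  ring

theorem warpedMetric_zero (s : ℝ) (V W : EuclideanSpace ℝ (Fin n) × ℝ) :
    warpedMetric ξ ψ (0, s) V W = inner ℝ V.1 W.1 + Real.exp (-2 * ψ 0) * (V.2 * W.2) := by
  simp [warpedMetric, modelMetric]

theorem fderiv_warpedMetric_apply (hx : x ≠ 0) {ξ' ψ' : ℝ} (hξ : HasDerivAt ξ ξ' ‖x‖)
    (hψ : HasDerivAt ψ ψ' ‖x‖) (s : ℝ) (V W Z : EuclideanSpace ℝ (Fin n) × ℝ) :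
    fderiv ℝ (fun q => warpedMetric ξ ψ q V W) (x, s) Z =
      (2 * ξ ‖x‖ * (ξ' * ‖x‖ - ξ ‖x‖) / ‖x‖ ^ 4) * inner ℝ x Z.1 * inner ℝ V.1 W.1 +
      (-(2 * ξ ‖x‖ * (ξ' * ‖x‖ - ξ ‖x‖) / ‖x‖ ^ 4) - 2 * ((1 - (ξ ‖x‖ / ‖x‖) ^ 2) / ‖x‖ ^ 2))
        / ‖x‖ ^ 2 * inner ℝ x Z.1 * (inner ℝ x V.1 * inner ℝ x W.1) +
      (1 - (ξ ‖x‖ / ‖x‖) ^ 2) / ‖x‖ ^ 2 *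
        (inner ℝ Z.1 V.1 * inner ℝ x W.1 + inner ℝ x V.1 * inner ℝ Z.1 W.1) +
      -(2 * ψ' * Real.exp (-2 * ψ ‖x‖) / ‖x‖) * inner ℝ x Z.1 * (V.2 * W.2) := by
  have hr : ‖x‖ ≠ 0 := norm_ne_zero_iff.2 hx
  have ha : HasDerivAt (fun r => (ξ r / r) ^ 2)
      (‖x‖ * (2 * ξ ‖x‖ * (ξ' * ‖x‖ - ξ ‖x‖) / ‖x‖ ^ 4)) ‖x‖ := by
    refine ((hξ.div (hasDerivAt_id _) hr).pow 2).congr_deriv ?_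
    simp
    field_simp
  have hb : HasDerivAt (fun r => (1 - (ξ r / r) ^ 2) / r ^ 2)
      (‖x‖ * ((-(2 * ξ ‖x‖ * (ξ' * ‖x‖ - ξ ‖x‖) / ‖x‖ ^ 4) -
        2 * ((1 - (ξ ‖x‖ / ‖x‖) ^ 2) / ‖x‖ ^ 2)) / ‖x‖ ^ 2)) ‖x‖ := by
    refine ((ha.const_sub 1).div (hasDerivAt_pow 2 _) (pow_ne_zero 2 hr)).congr_deriv ?_
    simp
    field_simp
  have hφ : HasDerivAt (fun r => Real.exp (-2 * ψ r))
      (‖x‖ * -(2 * ψ' * Real.exp (-2 * ψ ‖x‖) / ‖x‖)) ‖x‖ := by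
    refine (hψ.const_mul (-2)).exp.congr_deriv ?_
    field_simp
  have hfst : HasFDerivAt (Prod.fst : EuclideanSpace ℝ (Fin n) × ℝ → _)
    (ContinuousLinearMap.fst ℝ (EuclideanSpace ℝ (Fin n)) ℝ) (x, s) := hasFDerivAt_fst
  have hA := (hasFDerivAt_comp_norm hx ha).comp (x, s) hfst
  have hB := (hasFDerivAt_comp_norm hx hb).comp (x, s) hfst
  have hC := (hasFDerivAt_comp_norm hx hφ).comp (x, s) hfst
  have hV := hfst.inner ℝ (hasFDerivAt_const V.1 (x, s))
  have hW := hfst.inner ℝ (hasFDerivAt_const W.1 (x, s))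
  have htot := ((hA.mul_const (inner ℝ V.1 W.1)).add (hB.mul (hV.mul hW))).add
    (hC.mul_const (V.2 * W.2))
  have heq : (fun q => warpedMetric ξ ψ q V W) =ᶠ[𝓝 (x, s)] fun q =>
      (ξ ‖q.1‖ / ‖q.1‖) ^ 2 * inner ℝ V.1 W.1 +
      (1 - (ξ ‖q.1‖ / ‖q.1‖) ^ 2) / ‖q.1‖ ^ 2 * (inner ℝ q.1 V.1 * inner ℝ q.1 W.1) +
      Real.exp (-2 * ψ ‖q.1‖) * (V.2 * W.2) := by
    filter_upwards [(isOpen_ne.preimage continuous_fst).mem_nhds (x := (x, s)) hx] with q hq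
    exact warpedMetric_of_ne_zero hq q.2 V W
  rw [heq.fderiv_eq]
  refine (congrArg (fun T => T Z) (HasFDerivAt.fderiv htot)).trans ?_
  simp
  ring

/-- Invariance under `y ↦ -y` makes the derivative at `0` equal to its own negative. -/
theorem hasFDerivAt_zero_of_comp_norm {E : Type} [NormedAddCommGroup E] [NormedSpace ℝ E]
    {f : ℝ → ℝ} (hf : DifferentiableAt ℝ (fun y : E => f ‖y‖) 0) :
    HasFDerivAt (fun y : E => f ‖y‖) (0 : E →L[ℝ] ℝ) 0 := by
  have h1 := hf.hasFDerivAt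
  have h2 : HasFDerivAt (fun y : E => -y) (-ContinuousLinearMap.id ℝ E) 0 :=
    (hasFDerivAt_id 0).neg
  have h3 := HasFDerivAt.comp (x := (0 : E)) (f := fun y : E => -y) (g := fun y : E => f ‖y‖)
    (g' := fderiv ℝ (fun y : E => f ‖y‖) 0) (by simpa using h1) h2
  have h4 : ((fun y : E => f ‖y‖) ∘ fun y => -y) = fun y : E => f ‖y‖ := by
    ext y
    simp
  rw [h4] at h3
  have h5 := h1.unique h3
  have h6 : fderiv ℝ (fun y : E => f ‖y‖) 0 = 0 := by
    ext v
    have := congrArg (fun T => T v) h5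
    simp at this
    simp
    linarith
  rwa [h6] at h1

/-- The metric differs from the Euclidean one by `e² - 1` times an expression bounded by `2‖v‖‖w‖`,
and `e² - 1` is `o(‖q‖)` because it is radial and differentiable at `0`. -/
theorem hasFDerivAt_modelMetric_zero {e : ℝ → ℝ} (he0 : e 0 = 1)
    (he : DifferentiableAt ℝ (fun y : EuclideanSpace ℝ (Fin n) => e ‖y‖) 0)
    (hξ : ∀ᶠ y : EuclideanSpace ℝ (Fin n) in 𝓝 0, ξ ‖y‖ = ‖y‖ * e ‖y‖)
    (v w : EuclideanSpace ℝ (Fin n)) :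
    HasFDerivAt (fun q => modelMetric ξ q v w) (0 : EuclideanSpace ℝ (Fin n) →L[ℝ] ℝ) 0 := by
  have h1 : HasFDerivAt (fun y : EuclideanSpace ℝ (Fin n) => e ‖y‖ ^ 2) (0 : _ →L[ℝ] ℝ) 0 :=
    hasFDerivAt_zero_of_comp_norm (f := fun r => e r ^ 2) (he.pow 2)
  rw [hasFDerivAt_iff_isLittleO] at h1 ⊢
  refine Asymptotics.IsBigO.trans_isLittleO ?_ h1
  refine Asymptotics.IsBigO.of_bound (2 * (‖v‖ * ‖w‖)) ?_
  filter_upwards [hξ] with q hq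
  rcases eq_or_ne q 0 with rfl | hq0
  · simp
  have hr : ‖q‖ ≠ 0 := norm_ne_zero_iff.2 hq0
  have h2 : modelMetric ξ q v w - inner ℝ v w =
      (e ‖q‖ ^ 2 - 1) * (inner ℝ v w - inner ℝ q v * inner ℝ q w / ‖q‖ ^ 2) := by
    simp only [modelMetric, if_neg hq0, hq]
    field_simp
    ring
  have h3 : |inner ℝ v w - inner ℝ q v * inner ℝ q w / ‖q‖ ^ 2| ≤ 2 * (‖v‖ * ‖w‖) := by
    have h4 := abs_real_inner_le_norm v w
    have h5 : |inner ℝ q v * inner ℝ q w / ‖q‖ ^ 2| ≤ ‖v‖ * ‖w‖ := by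
      rw [abs_div, abs_mul, abs_of_nonneg (sq_nonneg ‖q‖), div_le_iff₀ (by positivity)]
      calc |inner ℝ q v| * |inner ℝ q w| ≤ (‖q‖ * ‖v‖) * (‖q‖ * ‖w‖) :=
            mul_le_mul (abs_real_inner_le_norm q v) (abs_real_inner_le_norm q w) (abs_nonneg _)
              (by positivity)
        _ = ‖v‖ * ‖w‖ * ‖q‖ ^ 2 := by ring
    calc _ ≤ |inner ℝ v w| + |inner ℝ q v * inner ℝ q w / ‖q‖ ^ 2| := abs_sub _ _
      _ ≤ _ := by linarith
  have h6 : modelMetric ξ 0 v w = inner ℝ v w := by simp [modelMetric]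
  simp only [h6, h2, norm_zero, he0, zero_apply, sub_zero, one_pow, norm_mul,
    Real.norm_eq_abs]
  rw [mul_comm]
  exact mul_le_mul_of_nonneg_right h3 (abs_nonneg _)

/-- Makes the Christoffel term vanish at the pole, so that only the Hessian of the height remains
there. -/
theorem fderiv_warpedMetric_zero {e : ℝ → ℝ} (he0 : e 0 = 1)
    (he : DifferentiableAt ℝ (fun y : EuclideanSpace ℝ (Fin n) => e ‖y‖) 0)
    (hξ : ∀ᶠ y : EuclideanSpace ℝ (Fin n) in 𝓝 0, ξ ‖y‖ = ‖y‖ * e ‖y‖)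
    (hψ : DifferentiableAt ℝ (fun y : EuclideanSpace ℝ (Fin n) => ψ ‖y‖) 0)
    (s : ℝ) (V W : EuclideanSpace ℝ (Fin n) × ℝ) :
    fderiv ℝ (fun q => warpedMetric ξ ψ q V W) (0, s) = 0 := by
  have hfst : HasFDerivAt (Prod.fst : EuclideanSpace ℝ (Fin n) × ℝ → _)
    (ContinuousLinearMap.fst ℝ (EuclideanSpace ℝ (Fin n)) ℝ) (0, s) := hasFDerivAt_fst
  have h1 := (hasFDerivAt_modelMetric_zero he0 he hξ V.1 W.1).comp (0, s) hfst
  have h2 := (hasFDerivAt_zero_of_comp_norm (f := fun r => Real.exp (-2 * ψ r))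
    (hψ.const_mul (-2)).exp).comp (0, s) hfst
  refine (HasFDerivAt.congr_fderiv (h1.add (h2.mul_const (V.2 * W.2))) ?_).fderiv
  simp

end Metric

/-! ### Mean curvature of a radial graph. -/

section MeanCurvature

variable {n : ℕ} {ξ ψ u k : ℝ → ℝ} {x : EuclideanSpace ℝ (Fin n)}

/-- The last argument `(l • x, ν)` is the shape of a normal vector to a rotationally symmetric
graph. -/
theorem christoffelFirst_warpedMetric (hx : x ≠ 0) {ξ' ψ' : ℝ} (hξ : HasDerivAt ξ ξ' ‖x‖)
    (hψ : HasDerivAt ψ ψ' ‖x‖) (s l ν : ℝ) (V W : EuclideanSpace ℝ (Fin n) × ℝ) :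
    christoffelFirst (warpedMetric ξ ψ) (x, s) V W (l • x, ν) =
      l * (1 - ξ ‖x‖ * ξ' / ‖x‖) *
        (inner ℝ V.1 W.1 - inner ℝ x V.1 * inner ℝ x W.1 / ‖x‖ ^ 2) -
      ψ' * Real.exp (-2 * ψ ‖x‖) / ‖x‖ * (inner ℝ x V.1 * W.2 * ν + inner ℝ x W.1 * V.2 * ν -
        l * ‖x‖ ^ 2 * V.2 * W.2) := by
  have hr : ‖x‖ ≠ 0 := norm_ne_zero_iff.2 hx
  simp only [christoffelFirst, fderiv_warpedMetric_apply hx hξ hψ, inner_smul_right,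
    inner_smul_left, real_inner_self_eq_norm_sq, RCLike.conj_to_real, real_inner_comm x,
    real_inner_comm W.1 V.1]
  field_simp
  ring

theorem meanCurvature_radialGraphMap (hx : x ≠ 0) {ξ' ψ' k' : ℝ} (hξ : HasDerivAt ξ ξ' ‖x‖)
    (hξ0 : ξ ‖x‖ ≠ 0) (hψ : HasDerivAt ψ ψ' ‖x‖)
    (hu : ∀ᶠ y in 𝓝 x,
      HasFDerivAt (fun y : EuclideanSpace ℝ (Fin n) => u ‖y‖) (k ‖y‖ • innerSL ℝ y) y)
    (hk : HasDerivAt k k' ‖x‖) (l ν : ℝ) :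
    meanCurvature (warpedMetric ξ ψ) (radialGraphMap u) (l • x, ν) x = (1 / (n : ℝ)) *
      ((n - 1) * ((Real.exp (-2 * ψ ‖x‖) * ν * k ‖x‖ + l * (1 - ξ ‖x‖ * ξ' / ‖x‖)) /
          (ξ ‖x‖ / ‖x‖) ^ 2) +
        (Real.exp (-2 * ψ ‖x‖) * ν * (k ‖x‖ + ‖x‖ * k') -
          ψ' * ‖x‖ * Real.exp (-2 * ψ ‖x‖) * (2 * k ‖x‖ * ν - l * ‖x‖ ^ 2 * k ‖x‖ ^ 2)) /
          (1 + Real.exp (-2 * ψ ‖x‖) * k ‖x‖ ^ 2 * ‖x‖ ^ 2)) := by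
  have hr : ‖x‖ ≠ 0 := norm_ne_zero_iff.2 hx
  have hux := hu.self_of_nhds
  have hkx : HasFDerivAt (fun y : EuclideanSpace ℝ (Fin n) => k ‖y‖)
      ((k' / ‖x‖) • innerSL ℝ x) x :=
    hasFDerivAt_comp_norm hx (by rwa [mul_div_cancel₀ _ hr])
  have hpos : 0 < 1 + Real.exp (-2 * ψ ‖x‖) * k ‖x‖ ^ 2 * ‖x‖ ^ 2 := by positivity
  -- The squared length `1 + e^{-2ψ} u'²` of the radial tangent vector, with `u' = ‖x‖ k`.
  have hden : (ξ ‖x‖ / ‖x‖) ^ 2 + ((1 - (ξ ‖x‖ / ‖x‖) ^ 2) / ‖x‖ ^ 2 +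
      Real.exp (-2 * ψ ‖x‖) * k ‖x‖ ^ 2) * ‖x‖ ^ 2 =
      1 + Real.exp (-2 * ψ ‖x‖) * k ‖x‖ ^ 2 * ‖x‖ ^ 2 := by
    field_simp
    ring
  rw [meanCurvature_eq_of_forms (a := (ξ ‖x‖ / ‖x‖) ^ 2)
    (b := (1 - (ξ ‖x‖ / ‖x‖) ^ 2) / ‖x‖ ^ 2 + Real.exp (-2 * ψ ‖x‖) * k ‖x‖ ^ 2)
    (α := Real.exp (-2 * ψ ‖x‖) * ν * k ‖x‖ + l * (1 - ξ ‖x‖ * ξ' / ‖x‖))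
    (β := Real.exp (-2 * ψ ‖x‖) * ν * (k' / ‖x‖) - l * (1 - ξ ‖x‖ * ξ' / ‖x‖) / ‖x‖ ^ 2 -
      ψ' * Real.exp (-2 * ψ ‖x‖) / ‖x‖ * (2 * k ‖x‖ * ν - l * ‖x‖ ^ 2 * k ‖x‖ ^ 2))
    (pow_ne_zero 2 (div_ne_zero hξ0 hr)) (hden ▸ hpos.ne'), hden]
  · congr 3
    field_simp
    ring
  · intro v w
    rw [firstForm, fderiv_radialGraphMap_apply hux, fderiv_radialGraphMap_apply hux,
      radialGraphMap, warpedMetric_of_ne_zero hx]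
    ring
  · intro v w
    rw [secondForm, fderiv_fderiv_radialGraphMap_apply hu hkx, fderiv_radialGraphMap_apply hux,
      fderiv_radialGraphMap_apply hux, radialGraphMap, warpedMetric_of_ne_zero hx,
      christoffelFirst_warpedMetric hx hξ hψ]
    simp
    field_simp
    ring

theorem meanCurvature_radialGraphMap_zero (hn : 1 ≤ n) {e : ℝ → ℝ} (he0 : e 0 = 1)
    (he : DifferentiableAt ℝ (fun y : EuclideanSpace ℝ (Fin n) => e ‖y‖) 0)
    (hξ : ∀ᶠ y : EuclideanSpace ℝ (Fin n) in 𝓝 0, ξ ‖y‖ = ‖y‖ * e ‖y‖)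
    (hψ : DifferentiableAt ℝ (fun y : EuclideanSpace ℝ (Fin n) => ψ ‖y‖) 0)
    (hu : ∀ᶠ y in 𝓝 (0 : EuclideanSpace ℝ (Fin n)),
      HasFDerivAt (fun y : EuclideanSpace ℝ (Fin n) => u ‖y‖) (k ‖y‖ • innerSL ℝ y) y)
    (hk : DifferentiableAt ℝ (fun y : EuclideanSpace ℝ (Fin n) => k ‖y‖) 0) (ν : ℝ) :
    meanCurvature (warpedMetric ξ ψ) (radialGraphMap u) (0, ν) (0 : EuclideanSpace ℝ (Fin n)) =
      Real.exp (-2 * ψ 0) * ν * k 0 := by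
  have hux := hu.self_of_nhds
  refine meanCurvature_eq_of_forms_zero hn (fun v w => ?_) fun v w => ?_
  · rw [firstForm, fderiv_radialGraphMap_apply hux, fderiv_radialGraphMap_apply hux,
      radialGraphMap, warpedMetric_zero]
    simp
  · rw [secondForm, fderiv_fderiv_radialGraphMap_apply hu hk.hasFDerivAt, radialGraphMap,
      warpedMetric_zero]
    simp only [christoffelFirst, fderiv_warpedMetric_zero he0 he hξ hψ]
    simp
    ring

/-- The curvature equation in terms of the radial profile `w = c V / A`, whose derivative is
prescribed by `(A w)' = c A`. -/
theorem curvature_identity {m r ξ ξ' ψ ψ' w c σ : ℝ} (hr : 0 < r) (hξ : 0 < ξ) (hσ : 0 < σ)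
    (hσw : σ ^ 2 = 1 - w ^ 2) :
    m * ((Real.exp (-2 * ψ) * (Real.exp ψ * σ) * (-(Real.exp ψ * w / (r * σ))) +
          w / r * (1 - ξ * ξ' / r)) / (ξ / r) ^ 2) +
      (Real.exp (-2 * ψ) * (Real.exp ψ * σ) *
          (-(Real.exp ψ * (ψ' * w / σ + (c + w * ψ' - m * (w * ξ' / ξ)) / σ ^ 3))) -
        ψ' * r * Real.exp (-2 * ψ) * (2 * (-(Real.exp ψ * w / (r * σ))) * (Real.exp ψ * σ) -
          w / r * r ^ 2 * (-(Real.exp ψ * w / (r * σ))) ^ 2)) /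
        (1 + Real.exp (-2 * ψ) * (-(Real.exp ψ * w / (r * σ))) ^ 2 * r ^ 2) = -c := by
  have hE : Real.exp (-2 * ψ) = (Real.exp ψ ^ 2)⁻¹ := by
    rw [← Real.exp_nat_mul, ← Real.exp_neg]
    congr 1
    push_cast
    ring
  rw [hE]
  have hEpos := Real.exp_pos ψ
  set E := Real.exp ψ
  have hden : 1 + (E ^ 2)⁻¹ * (-(E * w / (r * σ))) ^ 2 * r ^ 2 = 1 / σ ^ 2 := by
    field_simp
    linarith
  rw [hden]
  field_simp
  linear_combination (w * ξ ^ 2 * ψ') * hσw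

end MeanCurvature

/-- The quotient `u'(r) / r` for the height function `u`, in terms of `Q = V / (r A)`. -/
noncomputable def slopeQuotient (c : ℝ) (ψ Q : ℝ → ℝ) (r : ℝ) : ℝ :=
  -(Real.exp (ψ r) * (c * Q r) / √(1 - (c * r * Q r) ^ 2))

/-! ### The unit normal and the constant mean curvature. -/

section Curvature

variable {n : ℕ} {R : EReal} {ξ ψ u Q : ℝ → ℝ} {c : ℝ} {x : EuclideanSpace ℝ (Fin n)}

theorem hasDerivAt_area {r ξ' ψ' : ℝ} (hξ : HasDerivAt ξ ξ' r) (hψ : HasDerivAt ψ ψ' r)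
    (hξ0 : ξ r ≠ 0) :
    HasDerivAt (area n ξ ψ) (area n ξ ψ r * (-ψ' + (n - 1 : ℕ) * (ξ' / ξ r))) r := by
  refine (hψ.neg.exp.mul (hξ.pow (n - 1))).congr_deriv ?_
  simp only [area, Pi.pow_apply, Pi.neg_apply]
  rcases Nat.eq_zero_or_pos (n - 1) with h | h
  · simp [h]
  · obtain ⟨m, hm⟩ : ∃ m, n - 1 = m + 1 := ⟨n - 1 - 1, by omega⟩
    rw [hm, Nat.add_sub_cancel, pow_succ]
    field_simp

/-- From `V' = A` one gets `w' = c - w A'/A`, the prescribed curvature equation `(A w)' = c A`. -/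
theorem hasDerivAt_vol_div_area (hξ : IsModelWarping R ξ) (hψc : ContinuousOn ψ (radii R))
    {r ξ' ψ' : ℝ} (hr : r ∈ radii R) (h0 : 0 < r) (hξ' : HasDerivAt ξ ξ' r)
    (hψ : HasDerivAt ψ ψ' r) (c : ℝ) :
    HasDerivAt (fun r => c * vol n ξ ψ r / area n ξ ψ r)
      (c + c * vol n ξ ψ r / area n ξ ψ r * ψ' -
        (n - 1 : ℕ) * (c * vol n ξ ψ r / area n ξ ψ r * ξ' / ξ r)) r := by
  have hA := (area_pos (n := n) (ψ := ψ) hξ hr h0).ne'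
  have hξ0 := (hξ.pos r h0 hr.2).ne'
  refine (((hasDerivAt_vol hξ hψc hr h0).const_mul c).div (hasDerivAt_area hξ' hψ hξ0)
    hA).congr_deriv ?_
  field_simp
  ring

/-- The gradient of `s - u` is `e^{2ψ} ∂_s - u' ∂_r`, of length `e^ψ / √(1 - w²)`. Normalized, it is
`w ∂_r + e^ψ √(1 - w²) ∂_s`, and `w ∂_r = (c Q) x` is regular at the pole. -/
theorem isUnitNormal_radialGraphMap
    (hu : HasFDerivAt (fun y : EuclideanSpace ℝ (Fin n) => u ‖y‖)
      (slopeQuotient c ψ Q ‖x‖ • innerSL ℝ x) x)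
    (hw : (c * ‖x‖ * Q ‖x‖) ^ 2 < 1) :
    IsUnitNormal (warpedMetric ξ ψ) (radialGraphMap u) x
      ((c * Q ‖x‖) • x, Real.exp (ψ ‖x‖) * √(1 - (c * ‖x‖ * Q ‖x‖) ^ 2)) := by
  have hσ : 0 < √(1 - (c * ‖x‖ * Q ‖x‖) ^ 2) := Real.sqrt_pos.2 (sub_pos.2 hw)
  have hσ2 : √(1 - (c * ‖x‖ * Q ‖x‖) ^ 2) ^ 2 = 1 - (c * ‖x‖ * Q ‖x‖) ^ 2 :=
    Real.sq_sqrt (sub_pos.2 hw).le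
  have hE : Real.exp (-2 * ψ ‖x‖) * Real.exp (ψ ‖x‖) ^ 2 = 1 := by
    rw [← Real.exp_nat_mul, ← Real.exp_add]
    simp
  have hK : Real.exp (-2 * ψ ‖x‖) * (slopeQuotient c ψ Q ‖x‖ *
      (Real.exp (ψ ‖x‖) * √(1 - (c * ‖x‖ * Q ‖x‖) ^ 2))) = -(c * Q ‖x‖) := by
    rw [slopeQuotient]
    generalize √(1 - (c * ‖x‖ * Q ‖x‖) ^ 2) = σ at hσ
    generalize Real.exp (-2 * ψ ‖x‖) = F at hE
    field_simp
    linear_combination (-(c * Q ‖x‖)) * hE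
  constructor
  · rcases eq_or_ne x 0 with rfl | hx
    · rw [radialGraphMap, warpedMetric_zero]
      simpa [← sq] using hE
    · have hr : ‖x‖ ≠ 0 := norm_ne_zero_iff.2 hx
      rw [radialGraphMap, warpedMetric_of_ne_zero hx]
      simp only [inner_smul_left, inner_smul_right, real_inner_self_eq_norm_sq,
        RCLike.conj_to_real]
      have : (ξ ‖x‖ / ‖x‖) ^ 2 * (c * Q ‖x‖ * (c * Q ‖x‖ * ‖x‖ ^ 2)) +
          (1 - (ξ ‖x‖ / ‖x‖) ^ 2) / ‖x‖ ^ 2 * (c * Q ‖x‖ * ‖x‖ ^ 2 * (c * Q ‖x‖ * ‖x‖ ^ 2)) =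
          (c * ‖x‖ * Q ‖x‖) ^ 2 := by
        field_simp
        ring
      rw [this]
      linear_combination √(1 - (c * ‖x‖ * Q ‖x‖) ^ 2) ^ 2 * hE + hσ2
  · intro v
    rw [fderiv_radialGraphMap_apply hu]
    rcases eq_or_ne x 0 with rfl | hx
    · rw [radialGraphMap, warpedMetric_zero]
      simp
    · have hr : ‖x‖ ≠ 0 := norm_ne_zero_iff.2 hx
      rw [radialGraphMap, warpedMetric_of_ne_zero hx]
      simp only [inner_smul_right, real_inner_self_eq_norm_sq, real_inner_comm x]
      have : (ξ ‖x‖ / ‖x‖) ^ 2 * (c * Q ‖x‖ * inner ℝ x v) +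
          (1 - (ξ ‖x‖ / ‖x‖) ^ 2) / ‖x‖ ^ 2 * (inner ℝ x v * (c * Q ‖x‖ * ‖x‖ ^ 2)) =
          c * Q ‖x‖ * inner ℝ x v := by
        field_simp
        ring
      rw [this]
      linear_combination inner ℝ x v * hK

theorem meanCurvature_radialGraphMap_of_ne_zero (hn : 1 ≤ n) (hξ : IsModelWarping R ξ)
    (hψ : ContDiffOn ℝ ∞ ψ (radii R)) (hQ : ∀ r ∈ radii R, vol n ξ ψ r = r * Q r * area n ξ ψ r)
    (hx : x ≠ 0) (hr : ‖x‖ ∈ radii R) (hw : (c * ‖x‖ * Q ‖x‖) ^ 2 < 1)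
    (hu : ∀ᶠ y in 𝓝 x, HasFDerivAt (fun y : EuclideanSpace ℝ (Fin n) => u ‖y‖)
      (slopeQuotient c ψ Q ‖y‖ • innerSL ℝ y) y) :
    meanCurvature (warpedMetric ξ ψ) (radialGraphMap u)
      ((c * Q ‖x‖) • x, Real.exp (ψ ‖x‖) * √(1 - (c * ‖x‖ * Q ‖x‖) ^ 2)) x = -c / n := by
  have hr0 : 0 < ‖x‖ := norm_pos_iff.2 hx
  have hnhds := radii_mem_nhds hr hr0
  have hξd : HasDerivAt ξ (deriv ξ ‖x‖) ‖x‖ :=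
    ((ContDiffOn.contDiffAt (s := radii R) hξ.smooth hnhds).differentiableAt
      (by simp)).hasDerivAt
  have hψd : HasDerivAt ψ (deriv ψ ‖x‖) ‖x‖ :=
    ((hψ.contDiffAt hnhds).differentiableAt (by simp)).hasDerivAt
  set ξ' := deriv ξ ‖x‖
  set ψ' := deriv ψ ‖x‖
  have hw' := hasDerivAt_vol_div_area (n := n) hξ hψ.continuousOn hr hr0 hξd hψd c
  have hweq : ∀ r ∈ radii R, 0 < r → c * vol n ξ ψ r / area n ξ ψ r = c * r * Q r :=
    fun r hr h0 => by
      have := (area_pos (n := n) (ψ := ψ) hξ hr h0).ne'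
      rw [hQ r hr]
      field_simp
  rw [hweq _ hr hr0] at hw'
  have hev : (fun r => c * vol n ξ ψ r / area n ξ ψ r) =ᶠ[𝓝 ‖x‖] fun r => c * r * Q r := by
    filter_upwards [hnhds, lt_mem_nhds hr0] with r h1 h2
    exact hweq r h1 h2
  replace hw' := hw'.congr_of_eventuallyEq hev.symm
  set w := c * ‖x‖ * Q ‖x‖ with hwdef
  set w' := c + w * ψ' - (n - 1 : ℕ) * (w * ξ' / ξ ‖x‖) with hw'def
  have hσ : 0 < √(1 - w ^ 2) := Real.sqrt_pos.2 (sub_pos.2 hw)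
  have hσ2 : √(1 - w ^ 2) ^ 2 = 1 - w ^ 2 := Real.sq_sqrt (sub_pos.2 hw).le
  -- This is `u''`, as the differentiated function is `u' = r k`.
  have hp : HasDerivAt (fun r => -(Real.exp (ψ r) * (c * r * Q r) / √(1 - (c * r * Q r) ^ 2)))
      (-(Real.exp (ψ ‖x‖) * (ψ' * w / √(1 - w ^ 2) + w' / √(1 - w ^ 2) ^ 3))) ‖x‖ := by
    have h1 := ((hw'.pow 2).const_sub 1).sqrt (sub_pos.2 hw).ne'
    refine ((hψd.exp.mul hw').div h1 hσ.ne').neg.congr_deriv ?_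
    simp only [Pi.mul_apply, Pi.pow_apply, ← hwdef]
    field_simp
    simp
    linear_combination (-2 * w') * hσ2
  have hk : HasDerivAt (slopeQuotient c ψ Q)
      ((-(Real.exp (ψ ‖x‖) * (ψ' * w / √(1 - w ^ 2) + w' / √(1 - w ^ 2) ^ 3)) * ‖x‖ -
        -(Real.exp (ψ ‖x‖) * w / √(1 - w ^ 2))) / ‖x‖ ^ 2) ‖x‖ := by
    refine HasDerivAt.congr_of_eventuallyEq
      ((hp.div (hasDerivAt_id ‖x‖) hr0.ne').congr_deriv (by simp [hwdef])) ?_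
    filter_upwards [lt_mem_nhds hr0] with r h2
    simp only [slopeQuotient, Pi.div_apply, id]
    field_simp
  have hkx : slopeQuotient c ψ Q ‖x‖ = -(Real.exp (ψ ‖x‖) * w / (‖x‖ * √(1 - w ^ 2))) := by
    rw [slopeQuotient, hwdef]
    field_simp
  have hl : c * Q ‖x‖ = w / ‖x‖ := by rw [hwdef]; field_simp
  have hξ0 := hξ.pos _ hr0 hr.2
  rw [meanCurvature_radialGraphMap hx hξd hξ0.ne' hψd hu hk, hkx, hl]
  -- The identity `k + r k' = u''`.
  have hkk : -(Real.exp (ψ ‖x‖) * w / (‖x‖ * √(1 - w ^ 2))) +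
      ‖x‖ * ((-(Real.exp (ψ ‖x‖) * (ψ' * w / √(1 - w ^ 2) + w' / √(1 - w ^ 2) ^ 3)) * ‖x‖ -
        -(Real.exp (ψ ‖x‖) * w / √(1 - w ^ 2))) / ‖x‖ ^ 2) =
      -(Real.exp (ψ ‖x‖) * (ψ' * w / √(1 - w ^ 2) + w' / √(1 - w ^ 2) ^ 3)) := by
    field_simp
    ring
  rw [hkk, hw'def, show ((n : ℝ) - 1) = ((n - 1 : ℕ) : ℝ) by push_cast [Nat.cast_sub hn]; ring,
    curvature_identity hr0 hξ0 hσ hσ2]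
  ring

theorem warpedMetric_vertical (p N : EuclideanSpace ℝ (Fin n) × ℝ) :
    warpedMetric ξ ψ p N (0, 1) = Real.exp (-2 * ψ ‖p.1‖) * N.2 := by
  simp [warpedMetric, modelMetric]

end Curvature

/-! ### The bound on the weighted height. -/

section Bound

variable {n : ℕ} {R : EReal} {ξ ψ u : ℝ → ℝ} {H₀ r₀ : ℝ}

theorem boundIntegrand_eq {r : ℝ} (hV : 0 < vol n ξ ψ r) :
    boundIntegrand n ξ ψ H₀ r = -(Real.exp (-ψ r) * heightIntegrand n ξ ψ H₀ r) := by
  have h1 : area n ξ ψ r ^ 2 / vol n ξ ψ r ^ 2 - n ^ 2 * H₀ ^ 2 =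
      (area n ξ ψ r ^ 2 - n ^ 2 * H₀ ^ 2 * vol n ξ ψ r ^ 2) / vol n ξ ψ r ^ 2 := by
    field_simp
  rw [boundIntegrand, heightIntegrand, h1, Real.sqrt_div' _ (sq_nonneg _), Real.sqrt_sq hV.le,
    Real.exp_neg]
  have := Real.exp_pos (ψ r)
  -- If the root is zero, division by zero makes both sides `0`, so no sign of the radicand is
  -- needed.
  rcases eq_or_ne √(area n ξ ψ r ^ 2 - n ^ 2 * H₀ ^ 2 * vol n ξ ψ r ^ 2) 0 with h | h
  · simp [h]
  · field_simp

theorem boundIntegrand_nonneg (hH₀ : H₀ ≤ 0) (r : ℝ) : 0 ≤ boundIntegrand n ξ ψ H₀ r := by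
  refine div_nonneg ?_ (Real.sqrt_nonneg _)
  rw [neg_nonneg]
  exact mul_nonpos_of_nonneg_of_nonpos (Nat.cast_nonneg n) hH₀

theorem intervalIntegrable_boundIntegrand (hr₀ : 0 < r₀)
    (hψ : ContinuousOn ψ (Icc 0 r₀)) (hV : ∀ r ∈ Ioo 0 r₀, 0 < vol n ξ ψ r)
    (hint : IntervalIntegrable (heightIntegrand n ξ ψ H₀) volume 0 r₀) :
    IntervalIntegrable (boundIntegrand n ξ ψ H₀) volume 0 r₀ := by
  have h1 : ContinuousOn (fun r => Real.exp (-ψ r)) (uIcc 0 r₀) := by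
    rw [uIcc_of_le hr₀.le]
    exact hψ.neg.rexp
  refine (hint.continuousOn_mul h1).neg.congr_uIoo fun r hr => ?_
  rw [uIoo_of_le hr₀.le] at hr
  exact (boundIntegrand_eq (hV r hr)).symm

/-- The height is `∫_r^{r₀} e^ψ b` with `b ≥ 0` the bound integrand: replace `e^ψ` by its supremum,
extend the integral to `[0, r₀]`, and bound `e^{-ψ(r)}` by the infimum of `ψ`. -/
theorem exp_mul_height_le (hH₀ : H₀ ≤ 0) (hr₀ : 0 < r₀) (hψ : ContinuousOn ψ (Icc 0 r₀))
    (hV : ∀ r ∈ Ioo 0 r₀, 0 < vol n ξ ψ r)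
    (hint : IntervalIntegrable (heightIntegrand n ξ ψ H₀) volume 0 r₀) {r : ℝ}
    (hr : r ∈ Icc 0 r₀) :
    Real.exp (-ψ r) * ∫ τ in r₀..r, heightIntegrand n ξ ψ H₀ τ ≤
      Real.exp (sSup (ψ '' Ico 0 r₀) - sInf (ψ '' Ico 0 r₀)) *
        ∫ τ in (0 : ℝ)..r₀, boundIntegrand n ξ ψ H₀ τ := by
  have hb := intervalIntegrable_boundIntegrand hr₀ hψ hV hint
  have hbpos : 0 ≤ ∫ τ in (0 : ℝ)..r₀, boundIntegrand n ξ ψ H₀ τ :=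
    intervalIntegral.integral_nonneg hr₀.le fun τ _ => boundIntegrand_nonneg hH₀ τ
  -- The extrema are over `[0, r₀)`, which omits `ψ(r₀)`; at `r = r₀` the height is zero anyway.
  rcases hr.2.eq_or_lt with rfl | hlt
  · rw [intervalIntegral.integral_same, mul_zero]
    positivity
  have himg : IsCompact (ψ '' Icc 0 r₀) := isCompact_Icc.image_of_continuousOn hψ
  have hsub : ψ '' Ico 0 r₀ ⊆ ψ '' Icc 0 r₀ := image_mono Ico_subset_Icc_self
  have hbdd : BddAbove (ψ '' Ico 0 r₀) := himg.bddAbove.mono hsub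
  have hbdd' : BddBelow (ψ '' Ico 0 r₀) := himg.bddBelow.mono hsub
  have huIcc : uIcc r r₀ ⊆ uIcc 0 r₀ := by
    rw [uIcc_of_le hr.2, uIcc_of_le hr₀.le]
    exact Icc_subset_Icc_left hr.1
  have h1 : -∫ τ in r..r₀, heightIntegrand n ξ ψ H₀ τ ≤
      ∫ τ in r..r₀, Real.exp (sSup (ψ '' Ico 0 r₀)) * boundIntegrand n ξ ψ H₀ τ := by
    rw [← intervalIntegral.integral_neg]
    refine intervalIntegral.integral_mono_on_of_le_Ioo hr.2 (hint.mono_set huIcc).neg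
      ((hb.mono_set huIcc).const_mul _) fun τ hτ => ?_
    have hτ' : τ ∈ Ioo 0 r₀ := ⟨hr.1.trans_lt hτ.1, hτ.2⟩
    have h2 : -heightIntegrand n ξ ψ H₀ τ = Real.exp (ψ τ) * boundIntegrand n ξ ψ H₀ τ := by
      rw [boundIntegrand_eq (hV τ hτ'), Real.exp_neg]
      have := Real.exp_pos (ψ τ)
      field_simp
    rw [h2]
    exact mul_le_mul_of_nonneg_right (Real.exp_le_exp.2
      (le_csSup hbdd (mem_image_of_mem ψ (Ioo_subset_Ico_self hτ')))) (boundIntegrand_nonneg hH₀ τ)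
  have h3 : ∫ τ in r..r₀, boundIntegrand n ξ ψ H₀ τ ≤
      ∫ τ in (0 : ℝ)..r₀, boundIntegrand n ξ ψ H₀ τ :=
    intervalIntegral.integral_mono_interval hr.1 hr.2 le_rfl
      (Eventually.of_forall fun τ => boundIntegrand_nonneg hH₀ τ) hb
  have h4 : Real.exp (-ψ r) ≤ Real.exp (-sInf (ψ '' Ico 0 r₀)) :=
    Real.exp_le_exp.2 (neg_le_neg (csInf_le hbdd' (mem_image_of_mem ψ ⟨hr.1, hlt⟩)))
  have h5 : ∫ τ in r₀..r, heightIntegrand n ξ ψ H₀ τ ≤ Real.exp (sSup (ψ '' Ico 0 r₀)) *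
      ∫ τ in (0 : ℝ)..r₀, boundIntegrand n ξ ψ H₀ τ := by
    rw [intervalIntegral.integral_symm]
    refine h1.trans ?_
    rw [intervalIntegral.integral_const_mul]
    exact mul_le_mul_of_nonneg_left h3 (Real.exp_pos _).le
  calc Real.exp (-ψ r) * ∫ τ in r₀..r, heightIntegrand n ξ ψ H₀ τ
      ≤ Real.exp (-ψ r) * (Real.exp (sSup (ψ '' Ico 0 r₀)) *
        ∫ τ in (0 : ℝ)..r₀, boundIntegrand n ξ ψ H₀ τ) :=
        mul_le_mul_of_nonneg_left h5 (Real.exp_pos _).le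
    _ ≤ Real.exp (-sInf (ψ '' Ico 0 r₀)) * (Real.exp (sSup (ψ '' Ico 0 r₀)) *
        ∫ τ in (0 : ℝ)..r₀, boundIntegrand n ξ ψ H₀ τ) :=
        mul_le_mul_of_nonneg_right h4 (by positivity)
    _ = _ := by
        rw [sub_eq_neg_add, Real.exp_add]
        ring

end Bound

/-! ### Consequences of the monotonicity of `A/V`. -/

section Comparison

variable {R : EReal} {f : ℝ → ℝ} {a : ℝ}

theorem deriv_neg_of_antitoneOn (ha : a ∈ radii R) (ha0 : 0 < a)
    (hf : AntitoneOn f {r : ℝ | 0 < r ∧ (r : EReal) < R}) (hd : deriv f a ≠ 0) :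
    deriv f a < 0 := by
  refine lt_of_le_of_ne ?_ hd
  have hn : {r : ℝ | 0 < r ∧ (r : EReal) < R} ∈ 𝓝 a :=
    inter_mem (Ioi_mem_nhds ha0) (isOpen_setOf_coe_lt.mem_nhds ha.2)
  rw [← derivWithin_of_mem_nhds hn]
  exact hf.derivWithin_nonpos

/-- Equality at some `t < a` would make `f` constant on `[t, a]`, forcing its derivative at `a` to
vanish. -/
theorem lt_of_antitoneOn_of_deriv_ne_zero (ha : a ∈ radii R)
    (hf : AntitoneOn f {r : ℝ | 0 < r ∧ (r : EReal) < R}) (hd : deriv f a ≠ 0) {t : ℝ}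
    (ht : t ∈ Ioo 0 a) : f a < f t := by
  have hmem : ∀ s ∈ Icc t a, s ∈ {r : ℝ | 0 < r ∧ (r : EReal) < R} := fun s hs =>
    ⟨ht.1.trans_le hs.1, (radii_of_le ha (ht.1.le.trans hs.1) hs.2).2⟩
  have hta := left_mem_Icc.2 ht.2.le
  have haa := right_mem_Icc.2 ht.2.le
  refine lt_of_le_of_ne (hf (hmem t hta) (hmem a haa) ht.2.le) fun heq => hd ?_
  have hconst : ∀ s ∈ Icc t a, f s = f a := fun s hs =>
    le_antisymm ((hf (hmem t hta) (hmem s hs) hs.1).trans_eq heq.symm)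
      (hf (hmem s hs) (hmem a haa) hs.2)
  have h1 : HasDerivWithinAt f (deriv f a) (Icc t a) a :=
    (differentiableAt_of_deriv_ne_zero hd).hasDerivAt.hasDerivWithinAt
  have h2 : HasDerivWithinAt f 0 (Icc t a) a :=
    (hasDerivWithinAt_const a (Icc t a) (f a)).congr hconst rfl
  exact (uniqueDiffOn_Icc ht.2 a haa).eq_deriv _ h1 h2

end Comparison

/-! ### The slope and the primitive of the height integrand. -/

section Height

variable {n : ℕ} {R : EReal} {ξ ψ Q : ℝ → ℝ} {c H₀ r₀ : ℝ}

theorem isOpen_setOf_abs_mem_radii : IsOpen {t : ℝ | |t| ∈ radii R} := by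
  have : {t : ℝ | |t| ∈ radii R} = abs ⁻¹' {r : ℝ | (r : EReal) < R} := by
    ext t
    exact ⟨fun h => h.2, fun h => ⟨abs_nonneg t, h⟩⟩
  rw [this]
  exact isOpen_setOf_coe_lt.preimage continuous_abs

theorem convex_setOf_abs_mem_radii : Convex ℝ {t : ℝ | |t| ∈ radii R} := by
  refine Set.OrdConnected.convex ⟨fun a ha b hb t ht => ?_⟩
  rcases le_total |a| |b| with h | h
  · exact radii_of_le hb (abs_nonneg t) ((abs_le_max_abs_abs ht.1 ht.2).trans_eq (max_eq_right h))
  · exact radii_of_le ha (abs_nonneg t) ((abs_le_max_abs_abs ht.1 ht.2).trans_eq (max_eq_left h))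

theorem heightIntegrand_eq (hn0 : n * H₀ = -c) {r : ℝ} (hA : 0 < area n ξ ψ r)
    (hQ : vol n ξ ψ r = r * Q r * area n ξ ψ r) :
    heightIntegrand n ξ ψ H₀ r = r * slopeQuotient c ψ Q r := by
  have h1 : area n ξ ψ r ^ 2 - n ^ 2 * H₀ ^ 2 * vol n ξ ψ r ^ 2 =
      area n ξ ψ r ^ 2 * (1 - (c * r * Q r) ^ 2) := by
    rw [hQ]
    linear_combination (-(n * H₀ - c) * (r * Q r * area n ξ ψ r) ^ 2) * hn0
  rw [heightIntegrand, slopeQuotient, h1, Real.sqrt_mul (sq_nonneg _), Real.sqrt_sq hA.le, hn0, hQ]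
  field_simp

theorem contDiffOn_slopeQuotient
    (hψ : ContDiffOn ℝ ∞ (fun x : EuclideanSpace ℝ (Fin n) => ψ ‖x‖) (modelBall n R))
    (hQ : ContDiffOn ℝ ∞ (fun x : EuclideanSpace ℝ (Fin n) => Q ‖x‖) (modelBall n R))
    (hr₀ : r₀ ∈ radii R) (hw : ∀ r ∈ Ico 0 r₀, (c * r * Q r) ^ 2 < 1) :
    ContDiffOn ℝ ∞ (fun x : EuclideanSpace ℝ (Fin n) => slopeQuotient c ψ Q ‖x‖)
      {x | ‖x‖ < r₀} := by
  have hsub : {x : EuclideanSpace ℝ (Fin n) | ‖x‖ < r₀} ⊆ modelBall n R := fun x hx =>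
    mem_modelBall_iff.2 (radii_of_le hr₀ (norm_nonneg x) (le_of_lt hx))
  have hD : ContDiffOn ℝ ∞ (fun x : EuclideanSpace ℝ (Fin n) => 1 - (c * ‖x‖ * Q ‖x‖) ^ 2)
      {x | ‖x‖ < r₀} := by
    -- Only even powers of the norm occur, and `‖x‖²` is smooth at the pole while `‖x‖` is not.
    have : ContDiffOn ℝ ∞ (fun x : EuclideanSpace ℝ (Fin n) => 1 - c ^ 2 * ‖x‖ ^ 2 * Q ‖x‖ ^ 2)
        {x | ‖x‖ < r₀} :=
      contDiffOn_const.sub ((contDiffOn_const.mul (contDiff_norm_sq ℝ).contDiffOn).mul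
        ((hQ.mono hsub).pow 2))
    refine this.congr fun x _ => ?_
    ring
  have hpos : ∀ x ∈ {x : EuclideanSpace ℝ (Fin n) | ‖x‖ < r₀},
      0 < 1 - (c * ‖x‖ * Q ‖x‖) ^ 2 := fun x hx => sub_pos.2 (hw _ ⟨norm_nonneg x, hx⟩)
  refine ContDiffOn.neg (ContDiffOn.div ((hψ.mono hsub).exp.mul
    (contDiffOn_const.mul (hQ.mono hsub))) (hD.sqrt fun x hx => (hpos x hx).ne') fun x hx => ?_)
  exact (Real.sqrt_pos.2 (hpos x hx)).ne'

/-- The height function as a smooth function of the square root of the distance to `r₀`. -/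
theorem exists_height_primitive (hn : 1 ≤ n)
    (hψ : ContDiffOn ℝ ∞ (fun x : EuclideanSpace ℝ (Fin n) => ψ ‖x‖) (modelBall n R))
    (hQ : ContDiffOn ℝ ∞ (fun x : EuclideanSpace ℝ (Fin n) => Q ‖x‖) (modelBall n R))
    (hr₀ : r₀ ∈ radii R) (h0 : 0 < r₀) (hw : ∀ r ∈ Ico 0 r₀, (c * r * Q r) ^ 2 < 1)
    (hw₀ : c * r₀ * Q r₀ = 1) (hd : deriv (fun r => 1 - (c * r * Q r) ^ 2) r₀ < 0) :
    ∃ (Φ : ℝ → ℝ) (J : Set ℝ), IsOpen J ∧ Icc 0 √r₀ ⊆ J ∧ ContDiffOn ℝ ∞ Φ J ∧ Φ 0 = 0 ∧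
      0 < deriv Φ 0 ∧
      ∀ r ∈ Ico 0 r₀, HasDerivAt (fun r => Φ √(r₀ - r)) (r * slopeQuotient c ψ Q r) r := by
  have hψ' := contDiffOn_abs_of_comp_norm (U := radii R) hn
    (hψ.mono fun x hx => mem_modelBall_iff.2 hx)
  have hQ' := contDiffOn_abs_of_comp_norm (U := radii R) hn
    (hQ.mono fun x hx => mem_modelBall_iff.2 hx)
  have hU : Ioc (-r₀) r₀ ⊆ {t : ℝ | |t| ∈ radii R} := fun t ht =>
    radii_of_le hr₀ (abs_nonneg t) (abs_le.2 ⟨ht.1.le, ht.2⟩)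
  have habs : ∀ t : ℝ, 1 - c ^ 2 * t ^ 2 * Q |t| ^ 2 = 1 - (c * |t| * Q |t|) ^ 2 := fun t => by
    rw [mul_pow, mul_pow, sq_abs]
  -- The data are extended to `(-r₀, r₀]`, with `|t|` inside `ψ` and `Q` and plain `t` as the linear
  -- factor. This makes `r = 0` an interior point, where the derivative is two-sided.
  obtain ⟨Φ, J, hJ, hJr, hΦ, hΦ0, hΦd, hder⟩ := exists_primitive_div_sqrt
    (isOpen_setOf_abs_mem_radii (R := R)) convex_setOf_abs_mem_radii h0 hU
    (D := fun t => 1 - c ^ 2 * t ^ 2 * Q |t| ^ 2)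
    (g := fun t => Real.exp (ψ |t|) * (c * t * Q |t|))
    (contDiffOn_const.sub ((contDiffOn_const.mul (contDiff_id.pow 2).contDiffOn).mul (hQ'.pow 2)))
    (hψ'.exp.mul ((contDiffOn_const.mul contDiffOn_id).mul hQ'))
    (by rw [habs, abs_of_pos h0, hw₀]; norm_num)
    (by
      have : (fun t => 1 - c ^ 2 * t ^ 2 * Q |t| ^ 2) =ᶠ[𝓝 r₀]
          fun r => 1 - (c * r * Q r) ^ 2 := by
        filter_upwards [lt_mem_nhds h0] with t ht
        rw [habs, abs_of_pos ht]
      rwa [this.deriv_eq])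
    (fun t ht => by
      rw [habs]
      exact sub_pos.2 (hw _ ⟨abs_nonneg t, abs_lt.2 ht⟩))
    (by
      simp only [abs_of_pos h0, hw₀]
      positivity)
  refine ⟨Φ, J, hJ, hJr, hΦ, hΦ0, hΦd, fun r hr => ?_⟩
  refine (hder r ⟨by linarith [hr.1], hr.2⟩).congr_deriv ?_
  rw [habs, abs_of_nonneg hr.1, slopeQuotient]
  ring

end Height

end KillingGraph

/-! ### Assembly of the theorem. -/

theorem mainTheorem11 (n : ℕ) (hn : 1 ≤ n) (R : EReal) (ξ ψ : ℝ → ℝ)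
    (hξ : KillingGraph.IsModelWarping R ξ)
    (hψ : ContDiffOn ℝ ∞ (fun x : EuclideanSpace ℝ (Fin n) => ψ ‖x‖)
      (KillingGraph.modelBall n R))
    (hmono : AntitoneOn (fun r => KillingGraph.area n ξ ψ r / KillingGraph.vol n ξ ψ r)
      {r : ℝ | 0 < r ∧ (r : EReal) < R})
    (H₀ : ℝ) (hH₀ : H₀ ≤ 0) (r₀ : ℝ) (hr₀ : 0 < r₀) (hr₀R : (r₀ : EReal) < R)
    (hiso : n * |H₀| = KillingGraph.area n ξ ψ r₀ / KillingGraph.vol n ξ ψ r₀)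
    (hnd : deriv (fun r => KillingGraph.area n ξ ψ r / KillingGraph.vol n ξ ψ r) r₀ ≠ 0) :
    ∃ (u : ℝ → ℝ) (S : Set (EuclideanSpace ℝ (Fin n) × ℝ)),
      -- the explicit height function, the integral being convergent
      IntervalIntegrable (KillingGraph.heightIntegrand n ξ ψ H₀) volume 0 r₀ ∧
      (∀ r ∈ Icc 0 r₀, u r = ∫ τ in r₀..r, KillingGraph.heightIntegrand n ξ ψ H₀ τ) ∧
      -- `S` is the Killing graph of `u` over the closed ball, a compact smooth hypersurface
      -- with boundary `∂B_{r₀}(o) × {0}`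
      S = KillingGraph.radialGraphMap u '' {x | ‖x‖ ≤ r₀} ∧
      IsCompact S ∧
      KillingGraph.IsHypersurfaceWithBoundary S {p | ‖p.1‖ = r₀ ∧ p.2 = 0} ∧
      ContDiffOn ℝ ∞ (fun x : EuclideanSpace ℝ (Fin n) => u ‖x‖) {x | ‖x‖ < r₀} ∧
      -- constant mean curvature with respect to the upward pointing unit normal
      (∀ x : EuclideanSpace ℝ (Fin n), ‖x‖ < r₀ → ∃ N : EuclideanSpace ℝ (Fin n) × ℝ,
        KillingGraph.IsUnitNormal (KillingGraph.warpedMetric ξ ψ)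
          (KillingGraph.radialGraphMap u) x N ∧
        0 < KillingGraph.warpedMetric ξ ψ (KillingGraph.radialGraphMap u x) N (0, 1) ∧
        KillingGraph.meanCurvature (KillingGraph.warpedMetric ξ ψ)
          (KillingGraph.radialGraphMap u) N x = H₀) ∧
      -- the bound of the weighted height, the integral being convergent
      IntervalIntegrable (KillingGraph.boundIntegrand n ξ ψ H₀) volume 0 r₀ ∧
      ∀ r ∈ Icc 0 r₀, Real.exp (-ψ r) * u r ≤
        Real.exp (sSup (ψ '' Ico 0 r₀) - sInf (ψ '' Ico 0 r₀)) *
          ∫ τ in (0 : ℝ)..r₀, KillingGraph.boundIntegrand n ξ ψ H₀ τ := by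
  open KillingGraph Filter Topology in
  have hmem : r₀ ∈ radii R := ⟨hr₀.le, hr₀R⟩
  have hR : 0 < R := lt_trans (by exact_mod_cast hr₀) hr₀R
  have hψr : ContDiffOn ℝ ∞ ψ (radii R) := contDiffOn_of_comp_norm hn hψ
  have hn' : (n : ℝ) ≠ 0 := by exact_mod_cast (by omega : n ≠ 0)
  obtain ⟨Q, hQ, hQ0, hVQ⟩ := exists_vol_eq_mul_area hn hR hξ hψ
  obtain ⟨e, he, he0, hξe, -⟩ := hξ.exists_quotient hR n
  have hApos : ∀ r ∈ radii R, 0 < r → 0 < area n ξ ψ r := fun r hr h => area_pos hξ hr h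
  have hVpos : ∀ r ∈ radii R, 0 < r → 0 < vol n ξ ψ r := fun r hr h =>
    vol_pos hξ hψr.continuousOn hr h
  have hball : ∀ r ∈ Icc 0 r₀, r ∈ radii R := fun r hr => radii_of_le hmem hr.1 hr.2
  -- the constant `c = n |H₀|` and the ratio `c V / A`
  set c : ℝ := n * |H₀| with hc
  have hnc : n * H₀ = -c := by rw [hc, abs_of_nonpos hH₀]; ring
  -- Positivity of `A/V` at `r₀` excludes `H₀ = 0`.
  have hcpos : 0 < c := by
    rw [hiso]
    exact div_pos (hApos _ hmem hr₀) (hVpos _ hmem hr₀)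
  have hratio : ∀ r ∈ radii R, 0 < r → c * r * Q r = c / (area n ξ ψ r / vol n ξ ψ r) := by
    intro r hr h
    have h1 := (hApos r hr h).ne'
    have h2 := (hVpos r hr h).ne'
    rw [div_div_eq_mul_div, eq_div_iff h1, hVQ r hr]
    ring
  have hw₀ : c * r₀ * Q r₀ = 1 := by
    rw [hratio _ hmem hr₀, ← hiso, div_self hcpos.ne']
  have hw : ∀ r ∈ Ico 0 r₀, (c * r * Q r) ^ 2 < 1 := by
    intro r hr
    rcases hr.1.eq_or_lt with rfl | h
    · simp
    · have hrm := hball r ⟨hr.1, hr.2.le⟩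
      have h1 := lt_of_antitoneOn_of_deriv_ne_zero hmem hmono hnd ⟨h, hr.2⟩
      simp only [← hiso] at h1
      rw [hratio r hrm h, sq_lt_one_iff₀ (div_nonneg hcpos.le (hcpos.trans h1).le),
        div_lt_one (hcpos.trans h1)]
      exact h1
  -- With `F = A/V`, `1 - (c/F)²` has derivative `2 F'/c` where `F = c`, and `F'(r₀) < 0`.
  have hd : deriv (fun r => 1 - (c * r * Q r) ^ 2) r₀ < 0 := by
    have h1 := deriv_neg_of_antitoneOn hmem hr₀ hmono hnd
    have h2 := (differentiableAt_of_deriv_ne_zero hnd).hasDerivAt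
    set F : ℝ → ℝ := fun r => area n ξ ψ r / vol n ξ ψ r with hF
    have hF0 : F r₀ = c := hiso.symm
    have h3 := (((hasDerivAt_const r₀ c).div h2 (by rw [hF0]; exact hcpos.ne')).pow 2).const_sub 1
    have hev : (fun r => 1 - (c * r * Q r) ^ 2) =ᶠ[𝓝 r₀] fun r => 1 - (c / F r) ^ 2 := by
      filter_upwards [radii_mem_nhds hmem hr₀, lt_mem_nhds hr₀] with r hr h
      rw [hratio r hr h]
    rw [hev.deriv_eq]
    refine (HasDerivAt.deriv h3).trans_lt ?_
    simp only [Pi.div_apply, hF0, div_self hcpos.ne']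
    have : -(((2 : ℕ) : ℝ) * 1 ^ (2 - 1) * ((0 * c - c * deriv F r₀) / c ^ 2)) =
        2 * deriv F r₀ / c := by
      field_simp
      ring
    rw [this]
    exact div_neg_of_neg_of_pos (by linarith) hcpos
  obtain ⟨Φ, J, hJ, hJr, hΦ, hΦ0, hΦd, hder⟩ :=
    exists_height_primitive hn hψ hQ hmem hr₀ hw hw₀ hd
  set u : ℝ → ℝ := fun r => Φ √(r₀ - r) with hu
  have hucont : ContinuousOn u (Icc 0 r₀) := by
    refine hΦ.continuousOn.comp (by fun_prop) fun r hr => hJr ⟨Real.sqrt_nonneg _, ?_⟩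
    exact Real.sqrt_le_sqrt (by linarith [hr.1])
  have hu0 : u r₀ = 0 := by simp [hu, hΦ0]
  have hderi : ∀ r ∈ Ioo 0 r₀, HasDerivAt u (heightIntegrand n ξ ψ H₀ r) r := fun r hr => by
    have hrm := hball r (Ioo_subset_Icc_self hr)
    rw [heightIntegrand_eq hnc (hApos r hrm hr.1) (hVQ r hrm)]
    exact hder r (Ioo_subset_Ico_self hr)
  -- Convergence needs no estimate at `r₀`: up to sign the integrand is the nonnegative derivative
  -- of a function continuous up to the endpoints.
  have hint : IntervalIntegrable (heightIntegrand n ξ ψ H₀) volume 0 r₀ := by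
    have h1 : IntervalIntegrable (fun r => -heightIntegrand n ξ ψ H₀ r) volume 0 r₀ := by
      refine intervalIntegral.intervalIntegrable_deriv_of_nonneg (g := fun r => -u r) ?_ ?_ ?_
      · rw [uIcc_of_le hr₀.le]
        exact hucont.neg
      · rw [min_eq_left hr₀.le, max_eq_right hr₀.le]
        exact fun r hr => (hderi r hr).neg
      · rw [min_eq_left hr₀.le, max_eq_right hr₀.le]
        intro r hr
        have hV := hVpos r (hball r (Ioo_subset_Icc_self hr)) hr.1
        have h2 : heightIntegrand n ξ ψ H₀ r ≤ 0 := by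
          refine div_nonpos_of_nonpos_of_nonneg ?_ (Real.sqrt_nonneg _)
          rw [hnc]
          have := mul_pos hcpos hV
          have h3 := mul_pos (Real.exp_pos (ψ r)) this
          linarith
        exact neg_nonneg.2 h2
    exact h1.neg.congr_uIoo fun r _ => neg_neg _
  have hformula : ∀ r ∈ Icc 0 r₀, u r = ∫ τ in r₀..r, heightIntegrand n ξ ψ H₀ τ := by
    intro r hr
    rw [intervalIntegral.integral_symm, intervalIntegral.integral_eq_sub_of_hasDerivAt_of_le hr.2
      (hucont.mono (Icc_subset_Icc_left hr.1)) (fun t ht => hderi t ⟨hr.1.trans_lt ht.1, ht.2⟩)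
      (hint.mono_set ?_), hu0]
    · ring
    · rw [uIcc_of_le hr.2, uIcc_of_le hr₀.le]
      exact Icc_subset_Icc_left hr.1
  have hopen : IsOpen {x : EuclideanSpace ℝ (Fin n) | ‖x‖ < r₀} :=
    isOpen_lt continuous_norm continuous_const
  have hu00 : HasDerivWithinAt u 0 (Ici 0) 0 := by
    have := (hder 0 ⟨le_rfl, hr₀⟩).hasDerivWithinAt (s := Ici 0)
    rwa [zero_mul] at this
  have hKsm := contDiffOn_slopeQuotient hψ hQ hmem hw
  have husm : ContDiffOn ℝ ∞ (fun x : EuclideanSpace ℝ (Fin n) => u ‖x‖) {x | ‖x‖ < r₀} :=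
    contDiffOn_infty_comp_norm hopen hu00
      (fun x hx _ => hder ‖x‖ ⟨norm_nonneg x, hx⟩) hKsm
  have hud : ∀ x : EuclideanSpace ℝ (Fin n), ‖x‖ < r₀ →
      HasFDerivAt (fun y : EuclideanSpace ℝ (Fin n) => u ‖y‖)
        (slopeQuotient c ψ Q ‖x‖ • innerSL ℝ x) x := fun x hx =>
    hasFDerivAt_comp_norm_of_lt hu00 fun _ => hder ‖x‖ ⟨norm_nonneg x, hx⟩
  have hψI : ContinuousOn ψ (Icc 0 r₀) := hψr.continuousOn.mono (Icc_subset_radii hmem)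
  have hVI : ∀ r ∈ Ioo 0 r₀, 0 < vol n ξ ψ r := fun r hr =>
    hVpos r (hball r (Ioo_subset_Icc_self hr)) hr.1
  refine ⟨u, _, hint, hformula, rfl, ?_, isHypersurfaceWithBoundary_radialGraph hr₀ hJ
    (hJr ⟨le_rfl, Real.sqrt_nonneg _⟩) hΦ hΦ0 hΦd (fun _ _ => rfl) husm, husm, ?_,
    intervalIntegrable_boundIntegrand hr₀ hψI hVI hint, ?_⟩
  · have hcl : {x : EuclideanSpace ℝ (Fin n) | ‖x‖ ≤ r₀} = Metric.closedBall 0 r₀ := by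
      ext x
      simp
    rw [hcl]
    refine (isCompact_closedBall _ _).image_of_continuousOn
      (continuousOn_id.prodMk (hucont.comp continuous_norm.continuousOn fun x hx => ?_))
    exact ⟨norm_nonneg x, by simpa using hx⟩
  · intro x hx
    have hxw := hw ‖x‖ ⟨norm_nonneg x, hx⟩
    have hxm := hball ‖x‖ ⟨norm_nonneg x, hx.le⟩
    have hev : ∀ᶠ y in 𝓝 x, HasFDerivAt (fun y : EuclideanSpace ℝ (Fin n) => u ‖y‖)
        (slopeQuotient c ψ Q ‖y‖ • innerSL ℝ y) y := by
      filter_upwards [hopen.mem_nhds hx] with y hy using hud y hy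
    refine ⟨_, isUnitNormal_radialGraphMap (hud x hx) hxw, ?_, ?_⟩
    · rw [warpedMetric_vertical]
      have := Real.sqrt_pos.2 (sub_pos.2 hxw)
      positivity
    · have hcn : -c / n = H₀ := by
        rw [← hnc]
        field_simp
      rcases eq_or_ne x 0 with rfl | hx0
      · have hnhds : modelBall n R ∈ 𝓝 (0 : EuclideanSpace ℝ (Fin n)) :=
          isOpen_modelBall.mem_nhds (mem_modelBall_iff.2 (by simpa using zero_mem_radii hR))
        have hz := meanCurvature_radialGraphMap_zero hn he0
          ((he.contDiffAt hnhds).differentiableAt (by simp))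
          (by filter_upwards [hnhds] with y hy using hξe _ (mem_modelBall_iff.1 hy))
          ((hψ.contDiffAt hnhds).differentiableAt (by simp)) hev
          ((hKsm.contDiffAt (hopen.mem_nhds hx)).differentiableAt (by simp))
          (Real.exp (ψ ‖(0 : EuclideanSpace ℝ (Fin n))‖) *
            √(1 - (c * ‖(0 : EuclideanSpace ℝ (Fin n))‖ *
              Q ‖(0 : EuclideanSpace ℝ (Fin n))‖) ^ 2))
        rw [smul_zero, hz, ← hcn]
        have hE : Real.exp (-2 * ψ 0) * Real.exp (ψ 0) ^ 2 = 1 := by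
          rw [← Real.exp_nat_mul, ← Real.exp_add]
          simp
        -- At the pole the curvature is `e^{-2ψ} · e^ψ · (-e^ψ c Q(0))`, and `Q(0) = 1/n`.
        simp only [slopeQuotient, norm_zero, hQ0, mul_zero, zero_mul, ne_eq, OfNat.ofNat_ne_zero,
          not_false_eq_true, zero_pow, sub_zero, Real.sqrt_one, mul_one, div_one]
        linear_combination (-(c / n)) * hE
      · rw [meanCurvature_radialGraphMap_of_ne_zero hn hξ hψr hVQ hx0 hxm hxw hev, hcn]
  · intro r hr
    rw [hformula r hr]
    exact exp_mul_height_le hH₀ hr₀ hψI hVI hint hr
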